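/- Let $n\in\mathbb N$, let $\operatorname{Sym}_n$ be the space of real symmetric $n\times n$ matrices and let $\operatorname{Sym}_n^+\subset\operatorname{Sym}_n$ be the manifold of symmetric positive definite (SPD) matrices, with tangent space $\operatorname{Sym}_n$ at every point. Consider on $\operatorname{Sym}_n^+$ one of the following three Riemannian metrics, indexed by $g\in\{le,lc,ai\}$, where $\langle A,B\rangle_F=\operatorname{tr}(A^TB)$: - (Log-Euclidean) $\langle V,W\rangle^{le}_P=\langle D\log_P(V),D\log_P(W)\rangle_F$, where $\log$ is the matrix logarithm and $D\log_P(V)$ its directional derivative at $P$ along $V$; - (Log-Cholesky) $\langle V,W\rangle^{lc}_P=\sum_{i>j}\widetilde V_{ij}\widetilde W_{ij}+\sum_i L_{ii}^{-2}\,\widetilde V_{ii}\widetilde W_{ii}$, where $L$ is the Cholesky factor of $P$ (lower triangular with positive diagonal, $P=LL^T$) and $\widetilde V=L\,(L^{-1}VL^{-T})_{\frac12}$, with $Y_{\frac12}$ the lower triangular part of $Y$ with its diagonal entries halved; - (Affine-Invariant) $\langle V,W\rangle^{ai}_P=\operatorname{tr}(P^{-1}VP^{-1}W)$. Let $\operatorname{Exp}^g_P$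 and $\operatorname{Log}^g_P$ be the Riemannian exponential and logarithmic maps at $P$, and let $\mathcal T^g_{P\to Q}$ be the parallel transport (of the Levi-Civita connection) along the geodesic from $P$ to $Q$. With $I_n$ the identity matrix, define for $P,Q,R\in\operatorname{Sym}_n^+$ $$P\oplus_g Q=\operatorname{Exp}^g_P\big(\mathcal T^g_{I_n\to P}(\operatorname{Log}^g_{I_n}(Q))\big),$$ let $\ominus_g P$ be the left inverse of $P$, i.e. $\ominus_g P\oplus_g P=I_n$, and define the gyroautomorphisms $$\operatorname{gyr}_g[P,Q]R=\big(\ominus_g(P\oplus_g Q)\big)\oplus_g\big(P\oplus_g(Q\oplus_g R)\big).$$ Let $\langle P,Q\rangle=\langle\operatorname{Log}^g_{I_n}(P),\operatorname{Log}^g_{I_n}(Q)\rangle^g_{I_n}$ be the SPD inner product, $\|P\|=\sqrt{\langle P,P\rangle}$ the SPD norm, and $d(P,Q)=\|\ominus_g P\oplus_g Q\|$ the SPD gyrodistance. **Theorem.** For every $g\in\{le,lc,ai\}$ and all $P,Q\in\operatorname{Sym}_n^+$, the map $\operatorname{gyr}_g[P,Q]:\operatorname{Sym}_n^+\to\operatorname{Sym}_n^+$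 is an SPD gyroisometry: for all $R,S\in\operatorname{Sym}_n^+$, $$d\big(\operatorname{gyr}_g[P,Q]R,\operatorname{gyr}_g[P,Q]S\big)=d(R,S).$$ -/

import Mathlib

open Matrix

noncomputable section

namespace SPDGyro

/-! Riemannian geometry of the open set of symmetric positive definite (SPD) matrices inside the
vector space of symmetric matrices, in its global linear chart. -/

/-- Real square matrices of size `n`. -/
abbrev Mat (n : ℕ) : Type := Matrix (Fin n) (Fin n) ℝ

/-- The space of real symmetric matrices, which is the tangent space of `SPD n` at every point. -/
abbrev Sym (n : ℕ) : Type := {A : Mat n // A.IsSymm}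

/-- The manifold of real symmetric positive definite matrices
(`Matrix.PosDef` over `ℝ` includes symmetry). -/
abbrev SPD (n : ℕ) : Type := {P : Mat n // P.PosDef}

instance (n : ℕ) : Nonempty (Sym n) := ⟨⟨1, Matrix.isSymm_one⟩⟩

/-- The identity matrix as a point of `SPD n`. -/
def one (n : ℕ) : SPD n := ⟨1, Matrix.PosDef.one⟩

instance (n : ℕ) : Nonempty (SPD n) := ⟨one n⟩

/-- The Frobenius inner product `∑ i j, A i j * B i j`. -/
def frob {n : ℕ} (A B : Mat n) : ℝ := (Aᵀ * B).trace

/-! ### The three metrics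

A metric is written as a function `g P V W`; only its values at SPD matrices `P` and symmetric
matrices `V`, `W` matter. -/

/-- The matrix logarithm of a symmetric matrix, through the spectral functional calculus. -/
def logm {n : ℕ} (P : Mat n) : Mat n := cfc Real.log P

/-- The directional derivative of the matrix logarithm at `P` along `W`. -/
def Dlogm {n : ℕ} (P W : Mat n) : Mat n := deriv (fun t : ℝ => logm (P + t • W)) 0

/-- The Log-Euclidean metric. -/
def metricLE {n : ℕ} (P V W : Mat n) : ℝ := frob (Dlogm P V) (Dlogm P W)

/-- `L` is a Cholesky factor of `P`: it is lower triangular with positive diagonal entries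
and `P = L Lᵀ`. -/
def IsCholesky {n : ℕ} (L P : Mat n) : Prop :=
  (∀ i j, i < j → L i j = 0) ∧ (∀ i, 0 < L i i) ∧ P = L * Lᵀ

/-- The Cholesky factor (it exists and is unique for an SPD matrix). -/
def cholesky {n : ℕ} (P : Mat n) : Mat n := Classical.epsilon fun L => IsCholesky L P

/-- The lower triangular part of a matrix, with the diagonal entries halved. -/
def lowerHalf {n : ℕ} (Y : Mat n) : Mat n :=
  Matrix.of fun i j => if j < i then Y i j else if i = j then Y i i / 2 else 0

/-- The Riemannian metric on lower triangular matrices `L` with positive diagonal entries: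
Frobenius on the strictly lower triangular part, and `L i i ^ (-2)`-weighted on the diagonal. -/
def metricLower {n : ℕ} (L X Y : Mat n) : ℝ :=
  (∑ i, ∑ j, if j < i then X i j * Y i j else 0) + ∑ i, X i i * Y i i / (L i i) ^ 2

/-- The differential at `P` of the map sending an SPD matrix to its Cholesky factor. -/
def Dcholesky {n : ℕ} (P W : Mat n) : Mat n :=
  cholesky P * lowerHalf ((cholesky P)⁻¹ * W * ((cholesky P)⁻¹)ᵀ)

/-- The Log-Cholesky metric. -/
def metricLC {n : ℕ} (P V W : Mat n) : ℝ :=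
  metricLower (cholesky P) (Dcholesky P V) (Dcholesky P W)

/-- The Affine-Invariant metric, `⟨P^(-1/2) V P^(-1/2), P^(-1/2) W P^(-1/2)⟩_F`
written as `tr (P⁻¹ V P⁻¹ W)`. -/
def metricAI {n : ℕ} (P V W : Mat n) : ℝ := (P⁻¹ * V * P⁻¹ * W).trace

/-- The index set of the metrics: Log-Euclidean, Log-Cholesky, Affine-Invariant. -/
inductive Geometry where
  | le : Geometry
  | lc : Geometry
  | ai : Geometry

/-- The Riemannian metric of each of the three geometries. -/
def metric {n : ℕ} : Geometry → Mat n → Mat n → Mat n → ℝ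
  | Geometry.le => metricLE
  | Geometry.lc => metricLC
  | Geometry.ai => metricAI

/-! ### Levi-Civita connection, geodesics, exponential map, parallel transport -/

/-- The derivative `∂_U (g(V, W))` at `P` of the metric coefficient `P ↦ g P V W`
along the constant field `U`. -/
def metricDeriv {n : ℕ} (g : Mat n → Mat n → Mat n → ℝ) (P U V W : Mat n) : ℝ :=
  deriv (fun t : ℝ => g (P + t • U) V W) 0

/-- The Christoffel symbol of the first kind: the Levi-Civita connection of `g` satisfies
`g(∇_U V, Z) = christoffel g P U V Z` for constant fields `U`, `V`, `Z`. -/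
def christoffel {n : ℕ} (g : Mat n → Mat n → Mat n → ℝ) (P U V Z : Mat n) : ℝ :=
  (metricDeriv g P U V Z + metricDeriv g P V U Z - metricDeriv g P Z U V) / 2

/-- `u` is the velocity field of the curve `γ`. -/
def IsVelocity {n : ℕ} (γ : ℝ → SPD n) (u : ℝ → Sym n) : Prop :=
  ∀ t, HasDerivAt (fun s => (γ s : Mat n)) (u t : Mat n) t

/-- The vector field `V` along the curve `γ` with velocity `u` is differentiable and parallel:
its covariant derivative `V' + Γ_γ(u, V)` vanishes, that is, is `g`-orthogonal to every
tangent vector `Z`. -/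
def IsParallel {n : ℕ} (g : Mat n → Mat n → Mat n → ℝ) (γ : ℝ → SPD n) (u V : ℝ → Sym n) : Prop :=
  ∀ t, ∃ V' : Sym n, HasDerivAt (fun s => (V s : Mat n)) (V' : Mat n) t ∧
    ∀ Z : Sym n, g (γ t) V' Z + christoffel g (γ t) (u t) (V t) Z = 0

/-- `γ` is a geodesic with velocity `u`: its velocity is parallel along it. -/
def IsGeodesic {n : ℕ} (g : Mat n → Mat n → Mat n → ℝ) (γ : ℝ → SPD n) (u : ℝ → Sym n) : Prop :=
  IsVelocity γ u ∧ IsParallel g γ u u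

/-- The exponential map `Exp_P(W)`: the value at time `1` of the geodesic starting at `P` with
initial velocity `W` (the three geometries are geodesically complete). -/
def Exp {n : ℕ} (g : Mat n → Mat n → Mat n → ℝ) (P : SPD n) (W : Sym n) : SPD n :=
  Classical.epsilon fun Q => ∃ γ u, IsGeodesic g γ u ∧ γ 0 = P ∧ u 0 = W ∧ γ 1 = Q

/-- The logarithmic map `Log_P(Q)`: the tangent vector `W` at `P` with `Exp_P(W) = Q`
(for the three geometries `Exp_P` is a bijection). -/
def Log {n : ℕ} (g : Mat n → Mat n → Mat n → ℝ) (P Q : SPD n) : Sym n :=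
  Classical.epsilon fun W => Exp g P W = Q

/-- The parallel transport `T_{P → Q}(W)` of `W` along the geodesic from `P` to `Q`. -/
def transport {n : ℕ} (g : Mat n → Mat n → Mat n → ℝ) (P Q : SPD n) (W : Sym n) : Sym n :=
  Classical.epsilon fun W' => ∃ γ u V, IsGeodesic g γ u ∧ γ 0 = P ∧ γ 1 = Q ∧
    IsParallel g γ u V ∧ V 0 = W ∧ V 1 = W'

/-! ### The gyro-structure -/

/-- The binary operation `P ⊕ Q = Exp_P (T_{I → P} (Log_I Q))`. -/
def oplus {n : ℕ} (g : Geometry) (P Q : SPD n) : SPD n :=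
  Exp (metric g) P (transport (metric g) (one n) P (Log (metric g) (one n) Q))

/-- The left inverse `⊖ Y`, with `⊖ Y ⊕ Y = I`. -/
def ominus {n : ℕ} (g : Geometry) (Y : SPD n) : SPD n :=
  Classical.epsilon fun X => oplus g X Y = one n

/-- The gyroautomorphism `gyr[P, Q] R = (⊖ (P ⊕ Q)) ⊕ (P ⊕ (Q ⊕ R))`. -/
def gyr {n : ℕ} (g : Geometry) (P Q R : SPD n) : SPD n :=
  oplus g (ominus g (oplus g P Q)) (oplus g P (oplus g Q R))

/-- The SPD inner product `⟨P, Q⟩ = ⟨Log_I P, Log_I Q⟩_I`. -/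
def spdInner {n : ℕ} (g : Geometry) (P Q : SPD n) : ℝ :=
  metric g (one n : Mat n) (Log (metric g) (one n) P) (Log (metric g) (one n) Q)

/-- The SPD norm. -/
def spdNorm {n : ℕ} (g : Geometry) (P : SPD n) : ℝ := Real.sqrt (spdInner g P P)

/-- The SPD gyrodistance `d(P, Q) = ‖⊖ P ⊕ Q‖`. -/
def gyrodist {n : ℕ} (g : Geometry) (P Q : SPD n) : ℝ := spdNorm g (oplus g (ominus g P) Q)

/-- An SPD gyroisometry is a self-map of `SPD n` preserving the SPD gyrodistance. -/
def IsGyroisometry {n : ℕ} (g : Geometry) (ω : SPD n → SPD n) : Prop :=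
  ∀ P Q : SPD n, gyrodist g (ω P) (ω Q) = gyrodist g P Q

end SPDGyro

end

/-! Two mechanisms prove the theorem, and in both the gyroautomorphism is an explicit isometry.

The Log-Euclidean and Log-Cholesky metrics are flat: the matrix logarithm, respectively the Cholesky
factor with logarithms taken on its diagonal, is a global chart onto a vector space in which the
metric is a constant bilinear form. In such a chart geodesics are straight lines and parallel fields
are constant. The chart vanishes at the identity, so `oplus` becomes vector addition
(`FlatChart.chart_oplus`), and every gyroautomorphism is the identity map (`FlatChart.gyr_eq`).

For the Affine-Invariant metric the geodesic and transport equations reduce to one linear equation,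
solved by conjugation with a matrix exponential. This gives `P ⊕ Q = P^(1/2) Q P^(1/2)` (`oplus_ai`)
and `⊖ P = P⁻¹` (`ominus_ai`). Hence `gyr[P, Q]` is conjugation by `O = (P ⊕ Q)^(-1/2) P^(1/2)
Q^(1/2)`, which is orthogonal because `(P ⊕ Q)^(1/2)` squares to `P^(1/2) Q P^(1/2)`. Orthogonal
conjugation commutes with logarithm, root and inverse and preserves traces, hence preserves the
gyrodistance (`gyrodist_conj`).

`Exp`, `Log`, `transport` and `ominus` are chosen by `Classical.epsilon`, so each formula needs both
the existence of a suitable object and a computation valid for whichever one is chosen. -/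

noncomputable section

namespace SPDGyro

open Filter Topology NormedSpace

/-! ### Coordinates of symmetric and of lower triangular matrices -/

/-- Families of reals indexed by the entries on and below the diagonal. -/
abbrev Low (n : ℕ) : Type := {p : Fin n × Fin n // p.2 ≤ p.1} → ℝ

/-- The entries of a matrix on and below the diagonal. -/
def coords {n : ℕ} (A : Mat n) : Low n := fun p => A p.1.1 p.1.2

/-- The symmetric matrix with given entries on and below the diagonal. -/
def symOf {n : ℕ} (x : Low n) : Mat n :=
  Matrix.of fun i j => if h : j ≤ i then x ⟨(i, j), h⟩ else x ⟨(j, i), le_of_not_ge h⟩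

theorem symOf_isSymm {n : ℕ} (x : Low n) : (symOf x).IsSymm := by
  ext i j
  simp only [symOf, transpose_apply, of_apply]
  rcases lt_trichotomy i j with h | h | h
  · simp [h.le, h.not_ge]
  · subst h; rfl
  · simp [h.le, h.not_ge]

@[simp] theorem coords_symOf {n : ℕ} (x : Low n) : coords (symOf x) = x := by
  funext ⟨⟨i, j⟩, h⟩
  have h' : j ≤ i := h
  simp [coords, symOf, h']

theorem symOf_coords {n : ℕ} {A : Mat n} (h : A.IsSymm) : symOf (coords A) = A := by
  ext i j
  by_cases hij : j ≤ i
  · simp [symOf, coords, hij]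
  · simp [symOf, coords, h.apply]

theorem symOf_add {n : ℕ} (x y : Low n) : symOf (x + y) = symOf x + symOf y := by
  ext i j
  by_cases h : j ≤ i <;> simp [symOf, h]

theorem symOf_smul {n : ℕ} (t : ℝ) (x : Low n) : symOf (t • x) = t • symOf x := by
  ext i j
  by_cases h : j ≤ i <;> simp [symOf, h]

@[simp] theorem symOf_coords_sym {n : ℕ} (A : Sym n) : symOf (coords (A : Mat n)) = A :=
  symOf_coords A.2

theorem isSymm_of_posDef {n : ℕ} {P : Mat n} (h : P.PosDef) : P.IsSymm := by
  have := h.isHermitian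
  rwa [IsHermitian, conjTranspose_eq_transpose_of_trivial] at this

@[simp] theorem symOf_coords_spd {n : ℕ} (P : SPD n) : symOf (coords (P : Mat n)) = P :=
  symOf_coords (isSymm_of_posDef P.2)

theorem hasDerivAt_matrix {n : ℕ} {f : ℝ → Mat n} {f' : Mat n} {t : ℝ} :
    HasDerivAt f f' t ↔ ∀ i j, HasDerivAt (fun s => f s i j) (f' i j) t := by
  have h : HasDerivAt f f' t ↔ HasDerivAt (fun s i j => f s i j) (fun i j => f' i j) t := Iff.rfl
  rw [h, hasDerivAt_pi]
  exact forall_congr' fun i => hasDerivAt_pi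

theorem hasDerivAt_coords {n : ℕ} {f : ℝ → Mat n} {f' : Mat n} {t : ℝ} (h : HasDerivAt f f' t) :
    HasDerivAt (fun s => coords (f s)) (coords f') t :=
  hasDerivAt_pi.2 fun p => hasDerivAt_matrix.1 h p.1.1 p.1.2

theorem hasDerivAt_symOf {n : ℕ} {f : ℝ → Low n} {f' : Low n} {t : ℝ} (h : HasDerivAt f f' t) :
    HasDerivAt (fun s => symOf (f s)) (symOf f') t := by
  refine hasDerivAt_matrix.2 fun i j => ?_
  by_cases hij : j ≤ i
  · simpa [symOf, hij] using hasDerivAt_pi.1 h _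
  · simpa [symOf, hij] using hasDerivAt_pi.1 h _

theorem hasDerivAt_line {F : Type*} [NormedAddCommGroup F] [NormedSpace ℝ F] (P U : F) (t : ℝ) :
    HasDerivAt (fun s : ℝ => P + s • U) U t := by
  simpa using ((hasDerivAt_id t).smul_const U).const_add P

theorem hasDerivAt_clm_comp_apply {E F G : Type*} [NormedAddCommGroup E] [NormedSpace ℝ E]
    [NormedAddCommGroup F] [NormedSpace ℝ F] [NormedAddCommGroup G] [NormedSpace ℝ G]
    {D : E → F →L[ℝ] G} {D' : E →L[ℝ] F →L[ℝ] G} {x : ℝ → E} {x' : E} {v : ℝ → F} {v' : F} {t : ℝ}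
    (hD : HasFDerivAt D D' (x t)) (hx : HasDerivAt x x' t) (hv : HasDerivAt v v' t) :
    HasDerivAt (fun s => D (x s) (v s)) (D' x' (v t) + D (x t) v') t :=
  (hD.comp_hasDerivAt t hx).clm_apply hv

/-! ### Flat geometries -/

/-- A global chart of the manifold of SPD matrices in which the metric `g` is the constant
nondegenerate bilinear form `B`. -/
structure FlatChart {n : ℕ} (g : Mat n → Mat n → Mat n → ℝ) where
  /-- The bilinear form. -/
  B : Low n →L[ℝ] Low n →L[ℝ] ℝ
  /-- The chart. -/
  Φ : Low n → Low n
  /-- The inverse of the chart. -/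
  Ψ : Low n → Low n
  B_comm : ∀ x y, B x y = B y x
  B_nondeg : ∀ x, (∀ y, B x y = 0) → x = 0
  posDef : ∀ x, (symOf (Ψ x)).PosDef
  left_inv : ∀ x, Φ (Ψ x) = x
  right_inv : ∀ p : Low n, (symOf p).PosDef → Ψ (Φ p) = p
  contDiffAt : ∀ p : Low n, (symOf p).PosDef → ContDiffAt ℝ 2 Φ p
  contDiff : ContDiff ℝ 2 Ψ
  map_one : Φ (coords 1) = 0
  eventually_posDef : ∀ p : Low n, (symOf p).PosDef → ∀ᶠ q in 𝓝 p, (symOf q).PosDef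
  metric_eq : ∀ p v w : Low n, (symOf p).PosDef →
    g (symOf p) (symOf v) (symOf w) = B (fderiv ℝ Φ p v) (fderiv ℝ Φ p w)

namespace FlatChart

variable {n : ℕ} {g : Mat n → Mat n → Mat n → ℝ} (c : FlatChart g)

theorem hasFDerivAt {p : Low n} (hp : (symOf p).PosDef) :
    HasFDerivAt c.Φ (fderiv ℝ c.Φ p) p :=
  ((c.contDiffAt p hp).differentiableAt (by norm_num)).hasFDerivAt

theorem hasFDerivAt_fderiv {p : Low n} (hp : (symOf p).PosDef) :
    HasFDerivAt (fderiv ℝ c.Φ) (fderiv ℝ (fderiv ℝ c.Φ) p) p :=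
  (((c.contDiffAt p hp).fderiv_right (m := 1) (by norm_num)).differentiableAt
    (by norm_num)).hasFDerivAt

theorem hasFDerivAt_symm (x : Low n) : HasFDerivAt c.Ψ (fderiv ℝ c.Ψ x) x :=
  (c.contDiff.differentiable (by norm_num) x).hasFDerivAt

theorem fderiv_symm_fderiv {p : Low n} (hp : (symOf p).PosDef) (w : Low n) :
    fderiv ℝ c.Ψ (c.Φ p) (fderiv ℝ c.Φ p w) = w := by
  have h := (c.hasFDerivAt_symm (c.Φ p)).comp p (c.hasFDerivAt hp)
  have h2 : HasFDerivAt (c.Ψ ∘ c.Φ) (ContinuousLinearMap.id ℝ (Low n)) p :=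
    (hasFDerivAt_id p).congr_of_eventuallyEq (by
      filter_upwards [c.eventually_posDef p hp] with t ht using c.right_inv _ ht)
  exact DFunLike.congr_fun (h.unique h2) w

theorem fderiv_fderiv_symm {p : Low n} (hp : (symOf p).PosDef) (v : Low n) :
    fderiv ℝ c.Φ p (fderiv ℝ c.Ψ (c.Φ p) v) = v := by
  have e := c.right_inv p hp
  have h0 : HasFDerivAt c.Φ (fderiv ℝ c.Φ p) (c.Ψ (c.Φ p)) := by
    rw [e]; exact c.hasFDerivAt hp
  have h := h0.comp _ (c.hasFDerivAt_symm (c.Φ p))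
  have h2 : c.Φ ∘ c.Ψ = id := funext c.left_inv
  rw [h2] at h
  exact DFunLike.congr_fun (h.unique (hasFDerivAt_id _)) v

/-- Product rule applied to `B (DΦ v) (DΦ w)` along a line. The metric has this form only at
positive definite matrices, so their openness is needed to differentiate. -/
theorem metricDeriv_eq {p : Low n} (hp : (symOf p).PosDef) (u v w : Low n) :
    metricDeriv g (symOf p) (symOf u) (symOf v) (symOf w) =
      c.B (fderiv ℝ c.Φ p v) (fderiv ℝ (fderiv ℝ c.Φ) p u w) +
      c.B (fderiv ℝ (fderiv ℝ c.Φ) p u v) (fderiv ℝ c.Φ p w) := by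
  have h0 : HasDerivAt (fun t : ℝ => p + t • u) u 0 := hasDerivAt_line p u 0
  have e : p + (0 : ℝ) • u = p := by simp
  have hD : HasDerivAt (fun t : ℝ => fderiv ℝ c.Φ (p + t • u))
      (fderiv ℝ (fderiv ℝ c.Φ) p u) 0 := by
    refine HasFDerivAt.comp_hasDerivAt (f := fun t : ℝ => p + t • u) (0 : ℝ) ?_ h0
    rw [e]; exact c.hasFDerivAt_fderiv hp
  have hDX (X : Low n) : HasDerivAt (fun t : ℝ => fderiv ℝ c.Φ (p + t • u) X)
      (fderiv ℝ (fderiv ℝ c.Φ) p u X) 0 := by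
    simpa using hD.clm_apply (hasDerivAt_const (0 : ℝ) X)
  have hB := (c.B.hasFDerivAt.comp_hasDerivAt (0 : ℝ) (hDX v)).clm_apply (hDX w)
  simp only [e, Function.comp_apply] at hB
  rw [add_comm]
  refine (hB.congr_of_eventuallyEq ?_).deriv
  have ht : Tendsto (fun t : ℝ => p + t • u) (𝓝 0) (𝓝 p) := by
    have := h0.continuousAt.tendsto
    rwa [e] at this
  filter_upwards [ht.eventually (c.eventually_posDef p hp)] with t ht
  rw [← symOf_smul, ← symOf_add]
  exact c.metric_eq _ _ _ ht

/-- Of the six terms given by the three metric derivatives, the symmetry of `D²Φ` and of `B` cancels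
four and makes the other two equal. -/
theorem christoffel_eq {p : Low n} (hp : (symOf p).PosDef) (u v z : Low n) :
    christoffel g (symOf p) (symOf u) (symOf v) (symOf z) =
      c.B (fderiv ℝ (fderiv ℝ c.Φ) p u v) (fderiv ℝ c.Φ p z) := by
  have hs := (c.contDiffAt p hp).isSymmSndFDerivAt (by simp)
  rw [christoffel, c.metricDeriv_eq hp, c.metricDeriv_eq hp, c.metricDeriv_eq hp, hs.eq v u,
    hs.eq z u, hs.eq z v, c.B_comm (fderiv ℝ (fderiv ℝ c.Φ) p u z)]
  ring

theorem metric_add_christoffel {p : Low n} (hp : (symOf p).PosDef) (u v v' z : Low n) :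
    g (symOf p) (symOf v') (symOf z) + christoffel g (symOf p) (symOf u) (symOf v) (symOf z) =
      c.B (fderiv ℝ (fderiv ℝ c.Φ) p u v + fderiv ℝ c.Φ p v') (fderiv ℝ c.Φ p z) := by
  rw [c.christoffel_eq hp, c.metric_eq p v' z hp, map_add, add_comm]
  rfl

/-- The chart at an SPD matrix. -/
def chart (P : SPD n) : Low n := c.Φ (coords (P : Mat n))

/-- The differential of the chart. -/
def dchart (P : SPD n) (W : Sym n) : Low n := fderiv ℝ c.Φ (coords (P : Mat n)) (coords (W : Mat n))

theorem posDef_coords (P : SPD n) : (symOf (coords (P : Mat n))).PosDef := by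
  rw [symOf_coords_spd]; exact P.2

/-- The SPD matrix with given image under the chart. -/
def point (x : Low n) : SPD n := ⟨symOf (c.Ψ x), c.posDef x⟩

/-- The tangent vector with given image under the differential of the chart. -/
def vec (x v : Low n) : Sym n := ⟨symOf (fderiv ℝ c.Ψ x v), symOf_isSymm _⟩

@[simp] theorem chart_point (x : Low n) : c.chart (c.point x) = x := by
  simp [chart, point, c.left_inv]

@[simp] theorem point_chart (P : SPD n) : c.point (c.chart P) = P := by
  apply Subtype.ext
  simp [chart, point, c.right_inv _ (posDef_coords P)]

theorem chart_injective : Function.Injective c.chart :=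
  Function.LeftInverse.injective c.point_chart

@[simp] theorem dchart_vec (P : SPD n) (v : Low n) : c.dchart P (c.vec (c.chart P) v) = v := by
  simp [dchart, vec, chart, c.fderiv_fderiv_symm (posDef_coords P)]

@[simp] theorem vec_dchart (P : SPD n) (W : Sym n) : c.vec (c.chart P) (c.dchart P W) = W := by
  apply Subtype.ext
  simp [dchart, vec, chart, c.fderiv_symm_fderiv (posDef_coords P)]

theorem dchart_injective (P : SPD n) : Function.Injective (c.dchart P) :=
  Function.LeftInverse.injective (c.vec_dchart P)

theorem hasDerivAt_chart {γ : ℝ → SPD n} {u : ℝ → Sym n} (hγ : IsVelocity γ u) (t : ℝ) :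
    HasDerivAt (fun s => c.chart (γ s)) (c.dchart (γ t) (u t)) t :=
  (c.hasFDerivAt (posDef_coords (γ t))).comp_hasDerivAt t (hasDerivAt_coords (hγ t))

theorem hasDerivAt_dchart {γ : ℝ → SPD n} {u V : ℝ → Sym n} (hγ : IsVelocity γ u)
    {V' : Mat n} {t : ℝ} (hV : HasDerivAt (fun s => (V s : Mat n)) V' t) :
    HasDerivAt (fun s => c.dchart (γ s) (V s))
      (fderiv ℝ (fderiv ℝ c.Φ) (coords (γ t : Mat n)) (coords (u t : Mat n))
        (coords (V t : Mat n)) + fderiv ℝ c.Φ (coords (γ t : Mat n)) (coords V')) t :=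
  hasDerivAt_clm_comp_apply (x := fun s => coords (γ s : Mat n)) (v := fun s => coords (V s : Mat n))
    (c.hasFDerivAt_fderiv (posDef_coords (γ t))) (hasDerivAt_coords (hγ t)) (hasDerivAt_coords hV)

/-- The covariant derivative, read in the chart, is the ordinary derivative of `DΦ(V)`; it vanishes
exactly when these components are constant. -/
theorem isParallel_iff {γ : ℝ → SPD n} {u V : ℝ → Sym n} (hγ : IsVelocity γ u) :
    IsParallel g γ u V ↔ ∀ t, c.dchart (γ t) (V t) = c.dchart (γ 0) (V 0) := by
  constructor
  · intro h t
    have hd : ∀ t, HasDerivAt (fun s => c.dchart (γ s) (V s)) 0 t := by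
      intro t
      obtain ⟨V', hV', hZ⟩ := h t
      have h1 := c.hasDerivAt_dchart hγ hV'
      convert h1 using 1
      symm
      refine c.B_nondeg _ fun y => ?_
      -- The differential of the chart is onto, so a test vector can be chosen with arbitrary image
      -- `y`, and nondegeneracy of `B` applies.
      have h2 := hZ (c.vec (c.chart (γ t)) y)
      have h3 := c.metric_add_christoffel (posDef_coords (γ t)) (coords (u t : Mat n))
        (coords (V t : Mat n)) (coords (V' : Mat n))
        (coords (c.vec (c.chart (γ t)) y : Mat n))
      simp only [symOf_coords_spd, symOf_coords_sym] at h3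
      have h4 := c.dchart_vec (γ t) y
      rw [dchart] at h4
      rwa [h2, h4, eq_comm] at h3
    exact is_const_of_deriv_eq_zero (fun t => (hd t).differentiableAt) (fun t => (hd t).deriv) t 0
  · intro h t
    set w := c.dchart (γ 0) (V 0) with hw
    have hVeq : (fun s => (V s : Mat n)) = fun s => symOf (fderiv ℝ c.Ψ (c.chart (γ s)) w) := by
      funext s
      have := congrArg Subtype.val (c.vec_dchart (γ s) (V s))
      rw [h s] at this
      exact this.symm
    -- Differentiability of `V` is part of being parallel; it follows from `V = DΨ(w)` with `w`
    -- constant, since `Ψ` is twice differentiable.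
    have hΨ : Differentiable ℝ (fderiv ℝ c.Ψ) :=
      (c.contDiff.fderiv_right (m := 1) (by norm_num)).differentiable (by norm_num)
    have hV1 := hasDerivAt_symOf (hasDerivAt_clm_comp_apply (x := fun s => c.chart (γ s))
      (v := fun _ => w) (hΨ (c.chart (γ t))).hasFDerivAt (c.hasDerivAt_chart hγ t)
      (hasDerivAt_const t w))
    obtain ⟨v', hV'⟩ : ∃ v', HasDerivAt (fun s => (V s : Mat n)) (symOf v') t :=
      ⟨_, by rw [hVeq]; exact hV1⟩
    refine ⟨⟨symOf v', symOf_isSymm _⟩, hV', fun Z => ?_⟩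
    have h3 := c.metric_add_christoffel (posDef_coords (γ t)) (coords (u t : Mat n))
        (coords (V t : Mat n)) v' (coords (Z : Mat n))
    simp only [symOf_coords_spd, symOf_coords_sym] at h3
    have h1 := c.hasDerivAt_dchart hγ hV'
    rw [show (fun s => c.dchart (γ s) (V s)) = fun _ => w from funext h, coords_symOf] at h1
    rw [h1.unique (hasDerivAt_const t w)] at h3
    simpa using h3

theorem chart_geodesic {γ : ℝ → SPD n} {u : ℝ → Sym n} (h : IsGeodesic g γ u) (t : ℝ) :
    c.chart (γ t) = c.chart (γ 0) + t • c.dchart (γ 0) (u 0) := by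
  have h1 := (c.isParallel_iff h.1).1 h.2
  set w := c.dchart (γ 0) (u 0) with hw
  have hd : ∀ t, HasDerivAt (fun s => c.chart (γ s) - (0 + s • w)) 0 t := by
    intro t
    have h2 := (c.hasDerivAt_chart h.1 t).sub (hasDerivAt_line 0 w t)
    rwa [h1 t, sub_self] at h2
  have := is_const_of_deriv_eq_zero (fun t => (hd t).differentiableAt) (fun t => (hd t).deriv) t 0
  simp only [zero_add, zero_smul, sub_zero] at this
  rw [← this]; abel

theorem exists_isGeodesic (P : SPD n) (w : Low n) : ∃ γ u, IsGeodesic g γ u ∧ γ 0 = P ∧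
    (∀ t, c.chart (γ t) = c.chart P + t • w) ∧ ∀ t, c.dchart (γ t) (u t) = w := by
  let γ : ℝ → SPD n := fun t => c.point (c.chart P + t • w)
  have hγc (t) : c.chart (γ t) = c.chart P + t • w := c.chart_point _
  let u : ℝ → Sym n := fun t => c.vec (c.chart (γ t)) w
  have hu (t) : c.dchart (γ t) (u t) = w := c.dchart_vec _ _
  have hγ : IsVelocity γ u := fun t => by
    have := hasDerivAt_symOf (HasFDerivAt.comp_hasDerivAt (f := fun t : ℝ => c.chart P + t • w) t
      (c.hasFDerivAt_symm _) (hasDerivAt_line (c.chart P) w t))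
    have hut : u t = c.vec (c.chart P + t • w) w := by rw [← hγc]
    rw [hut]; exact this
  refine ⟨γ, u, ⟨hγ, (c.isParallel_iff hγ).2 fun t => by rw [hu, hu]⟩, ?_, hγc, hu⟩
  simp [γ]

/-- The straight line shows that the choice in `Exp` is not vacuous, and `chart_geodesic` gives the
endpoint of whichever geodesic was chosen. -/
theorem chart_Exp (P : SPD n) (W : Sym n) :
    c.chart (Exp g P W) = c.chart P + c.dchart P W := by
  obtain ⟨γ, u, hγ, h0, -, hu⟩ := c.exists_isGeodesic P (c.dchart P W)
  have hW : u 0 = W := c.dchart_injective P (by rw [← hu 0, h0])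
  obtain ⟨γ', u', h', h0', hu', h1'⟩ := Classical.epsilon_spec
    (p := fun Q => ∃ γ u, IsGeodesic g γ u ∧ γ 0 = P ∧ u 0 = W ∧ γ 1 = Q)
    ⟨γ 1, γ, u, hγ, h0, hW, rfl⟩
  rw [Exp, ← h1', c.chart_geodesic h' 1, h0', hu', one_smul]

theorem dchart_Log (P Q : SPD n) : c.dchart P (Log g P Q) = c.chart Q - c.chart P := by
  have h : Exp g P (Log g P Q) = Q := Classical.epsilon_spec (p := fun W => Exp g P W = Q)
    ⟨c.vec (c.chart P) (c.chart Q - c.chart P), c.chart_injective (by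
      rw [c.chart_Exp, c.dchart_vec]; abel)⟩
  conv_rhs => rw [← h, c.chart_Exp]
  abel

theorem dchart_transport (P Q : SPD n) (W : Sym n) :
    c.dchart Q (transport g P Q W) = c.dchart P W := by
  obtain ⟨γ, u, hγ, h0, hγc, hu⟩ := c.exists_isGeodesic P (c.chart Q - c.chart P)
  have h1 : γ 1 = Q := c.chart_injective (by rw [hγc]; simp)
  let V : ℝ → Sym n := fun t => c.vec (c.chart (γ t)) (c.dchart P W)
  have hV (t) : c.dchart (γ t) (V t) = c.dchart P W := c.dchart_vec _ _
  have hp : IsParallel g γ u V := (c.isParallel_iff hγ.1).2 fun t => by rw [hV, hV]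
  have hV0 : V 0 = W := c.dchart_injective P (by rw [← hV 0, h0])
  obtain ⟨γ', u', V', h', h0', h1', hp', hV', hV1⟩ := Classical.epsilon_spec
    (p := fun W' => ∃ γ u V, IsGeodesic g γ u ∧ γ 0 = P ∧ γ 1 = Q ∧
      IsParallel g γ u V ∧ V 0 = W ∧ V 1 = W') ⟨V 1, γ, u, V, hγ, h0, h1, hp, hV0, rfl⟩
  have := (c.isParallel_iff h'.1).1 hp' 1
  rw [h1', h0', hV', hV1] at this
  exact this

end FlatChart

/-! ### The gyro-structure of a flat geometry. -/

namespace FlatChart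

variable {n : ℕ} {g : Geometry} (c : FlatChart (metric (n := n) g))

theorem chart_oplus (P Q : SPD n) : c.chart (oplus g P Q) = c.chart P + c.chart Q := by
  have h1 : c.chart (one n) = 0 := c.map_one
  rw [oplus, c.chart_Exp, c.dchart_transport, c.dchart_Log, h1, sub_zero]

theorem chart_ominus (P : SPD n) : c.chart (ominus g P) = -c.chart P := by
  have h1 : c.chart (one n) = 0 := c.map_one
  have h : oplus g (ominus g P) P = one n :=
    Classical.epsilon_spec (p := fun X => oplus g X P = one n)
      ⟨c.point (-c.chart P), FlatChart.chart_injective c (by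
        rw [c.chart_oplus, h1, c.chart_point]; simp)⟩
  have h2 := c.chart_oplus (ominus g P) P
  rw [h, h1] at h2
  exact eq_neg_of_add_eq_zero_left h2.symm

include c in
theorem gyr_eq (P Q R : SPD n) : gyr g P Q R = R := by
  apply c.chart_injective
  simp only [gyr, c.chart_oplus, c.chart_ominus]
  abel

include c in
theorem isGyroisometry_gyr (P Q : SPD n) : IsGyroisometry g (gyr g P Q) := by
  intro R S
  rw [c.gyr_eq, c.gyr_eq]

end FlatChart

/-! ### Calculus of matrix-valued curves -/

section Normed

-- The norm is needed only for calculus in a Banach algebra; the resulting statements are used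
-- outside this section.
attribute [local instance] Matrix.linftyOpNormedRing Matrix.linftyOpNormedAlgebra

theorem hasDerivAt_exp_smul_matrix {n : ℕ} (A : Mat n) (t : ℝ) :
    HasDerivAt (fun s : ℝ => exp (s • A)) (A * exp (t • A)) t :=
  hasDerivAt_exp_smul_const' A t

theorem hasDerivAt_matrix_mul {n : ℕ} {f g : ℝ → Mat n} {f' g' : Mat n} {t : ℝ}
    (hf : HasDerivAt f f' t) (hg : HasDerivAt g g' t) :
    HasDerivAt (fun s => f s * g s) (f' * g t + f t * g') t :=
  HasDerivAt.mul hf hg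

theorem hasDerivAt_matrix_inv {n : ℕ} {f : ℝ → Mat n} {f' : Mat n} {t : ℝ}
    (hf : HasDerivAt f f' t) (h : IsUnit (f t)) :
    HasDerivAt (fun s => (f s)⁻¹) (-((f t)⁻¹ * f' * (f t)⁻¹)) t := by
  obtain ⟨x, hx⟩ := h
  have h1 : HasDerivAt (fun s => Ring.inverse (f s)) (-((↑x⁻¹ : Mat n) * f' * (↑x⁻¹ : Mat n))) t := by
    have h0 := hasFDerivAt_ringInverse (𝕜 := ℝ) x
    rw [hx] at h0
    exact h0.comp_hasDerivAt t hf
  have e : (fun s => (f s)⁻¹) = fun s => Ring.inverse (f s) :=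
    funext fun s => Matrix.nonsing_inv_eq_ringInverse _
  have e2 : (f t)⁻¹ = (↑x⁻¹ : Mat n) := by rw [← hx, Matrix.coe_units_inv]
  rw [e, e2]
  exact h1

theorem deriv_matrix {n : ℕ} {f : ℝ → Mat n} {f' : Mat n} {t : ℝ} (h : HasDerivAt f f' t) :
    deriv f t = f' :=
  HasDerivAt.deriv h

end Normed

theorem hasDerivAt_matrix_transpose {n : ℕ} {f : ℝ → Mat n} {f' : Mat n} {t : ℝ}
    (hf : HasDerivAt f f' t) : HasDerivAt (fun s => (f s)ᵀ) f'ᵀ t :=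
  hasDerivAt_matrix.2 fun i j => hasDerivAt_matrix.1 hf j i

theorem hasDerivAt_matrix_unique {n : ℕ} {f : ℝ → Mat n} {f' g' : Mat n} {t : ℝ}
    (hf : HasDerivAt f f' t) (hg : HasDerivAt f g' t) : f' = g' := by
  ext i j
  exact (hasDerivAt_matrix.1 hf i j).unique (hasDerivAt_matrix.1 hg i j)

theorem isSymm_of_hasDerivAt {n : ℕ} {f : ℝ → Mat n} {f' : Mat n} {t : ℝ}
    (h : HasDerivAt f f' t) (hf : ∀ s, (f s).IsSymm) : f'.IsSymm := by
  have h2 := hasDerivAt_matrix_transpose h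
  rw [show (fun s => (f s)ᵀ) = f from funext hf] at h2
  exact hasDerivAt_matrix_unique h2 h

theorem hasDerivAt_matrix_trace {n : ℕ} {f : ℝ → Mat n} {f' : Mat n} {t : ℝ}
    (hf : HasDerivAt f f' t) : HasDerivAt (fun s => (f s).trace) f'.trace t :=
  HasDerivAt.fun_sum fun i _ => hasDerivAt_matrix.1 hf i i

theorem matrix_eq_of_hasDerivAt_zero {n : ℕ} {f : ℝ → Mat n} (h : ∀ t, HasDerivAt f 0 t) (t : ℝ) :
    f t = f 0 := by
  ext i j
  have hd (t) := hasDerivAt_matrix.1 (h t) i j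
  exact is_const_of_deriv_eq_zero (fun t => (hd t).differentiableAt) (fun t => (hd t).deriv) t 0

/-! ### Matrix exponential and logarithm -/

/-- In an orthonormal eigenbasis both sides are the diagonal matrix of exponentials of the
eigenvalues. This links the spectrally defined `logm` to the power series `exp`. -/
theorem cfc_exp_eq {n : ℕ} {A : Mat n} (h : A.IsHermitian) : cfc Real.exp A = exp A := by
  rw [h.cfc_eq, IsHermitian.cfc]
  conv_rhs => rw [h.spectral_theorem]
  rw [Unitary.conjStarAlgAut_apply, Unitary.conjStarAlgAut_apply]
  have := exp_units_conj (Unitary.toUnits h.eigenvectorUnitary)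
    (diagonal (RCLike.ofReal ∘ h.eigenvalues) : Mat n)
  refine Eq.trans ?_ this.symm
  rw [exp_diagonal]
  have e : exp (RCLike.ofReal ∘ h.eigenvalues : Fin n → ℝ) =
      RCLike.ofReal ∘ Real.exp ∘ h.eigenvalues := by
    funext i
    rw [Pi.coe_exp]
    simp [Real.exp_eq_exp_ℝ]
  rw [e]
  rfl

theorem isHermitian_iff_isSymm {n : ℕ} {A : Mat n} : A.IsHermitian ↔ A.IsSymm := by
  rw [IsHermitian, conjTranspose_eq_transpose_of_trivial]; rfl

theorem continuousOn_spectrum {n : ℕ} (A : Mat n) (f : ℝ → ℝ) : ContinuousOn f (spectrum ℝ A) :=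
  Set.Finite.continuousOn Matrix.finite_real_spectrum f

theorem cfc_comp_matrix {n : ℕ} (g f : ℝ → ℝ) {A : Mat n} (h : A.IsHermitian) :
    cfc g (cfc f A) = cfc (g ∘ f) A :=
  (cfc_comp g f A h ((Matrix.finite_real_spectrum.image _).continuousOn _)
    (continuousOn_spectrum _ _)).symm

theorem logm_exp {n : ℕ} {A : Mat n} (h : A.IsSymm) : logm (exp A) = A := by
  have hA := isHermitian_iff_isSymm.2 h
  rw [logm, ← cfc_exp_eq hA, cfc_comp_matrix _ _ hA]
  have : Real.log ∘ Real.exp = id := funext Real.log_exp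
  rw [this]
  exact cfc_id ℝ A hA

theorem logm_isSymm {n : ℕ} (A : Mat n) : (logm A).IsSymm :=
  isHermitian_iff_isSymm.1 (cfc_predicate Real.log A)

theorem exp_logm {n : ℕ} {A : Mat n} (h : A.PosDef) : exp (logm A) = A := by
  have hA := h.isHermitian
  rw [← cfc_exp_eq (isHermitian_iff_isSymm.2 (logm_isSymm A)), logm,
    cfc_comp_matrix _ _ hA]
  refine Eq.trans (cfc_congr fun x hx => ?_) (cfc_id ℝ A hA)
  rw [hA.spectrum_real_eq_range_eigenvalues] at hx
  obtain ⟨i, rfl⟩ := hx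
  exact Real.exp_log (h.eigenvalues_pos i)

theorem posDef_mul_mul_transpose {n : ℕ} {A B : Mat n} (hA : A.PosDef) (hB : IsUnit B) :
    (B * A * Bᵀ).PosDef := by
  have := (Matrix.IsUnit.posDef_star_right_conjugate_iff (x := A) hB).2 hA
  rwa [star_eq_conjTranspose, conjTranspose_eq_transpose_of_trivial] at this

theorem exp_half_mul_half {n : ℕ} (A : Mat n) :
    exp ((1 / 2 : ℝ) • A) * exp ((1 / 2 : ℝ) • A) = exp A := by
  rw [← Matrix.exp_add_of_commute _ _ (Commute.refl _), ← add_smul]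
  norm_num

theorem posDef_exp {n : ℕ} {A : Mat n} (h : A.IsSymm) : (exp A).PosDef := by
  have := posDef_mul_mul_transpose PosDef.one (Matrix.isUnit_exp ((1 / 2 : ℝ) • A))
  rwa [mul_one, ← exp_transpose, transpose_smul, h.eq, exp_half_mul_half] at this

/-! ### Flat charts from smooth parametrizations -/

/-- In finite dimension an injective differential is invertible, so the inverse function theorem
applies, and a left inverse `Φ` must agree with the local inverse. Thus smoothness of the logarithm
and of the Cholesky map, as well as openness of the positive definite cone, follow from the
parametrization alone. -/
theorem contDiffAt_leftInverse {E : Type*} [NormedAddCommGroup E] [NormedSpace ℝ E]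
    [FiniteDimensional ℝ E] {Φ Ψ : E → E} (hl : ∀ x, Φ (Ψ x) = x) (hΨ : ContDiff ℝ 2 Ψ) (x : E)
    (hinj : ∀ v, fderiv ℝ Ψ x v = 0 → v = 0) :
    ContDiffAt ℝ 2 Φ (Ψ x) ∧ ∀ᶠ q in 𝓝 (Ψ x), Ψ (Φ q) = q := by
  have : CompleteSpace E := FiniteDimensional.complete ℝ E
  let e : E ≃L[ℝ] E := (LinearEquiv.ofInjectiveEndo (fderiv ℝ Ψ x).toLinearMap
    ((injective_iff_map_eq_zero _).2 hinj)).toContinuousLinearEquiv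
  have he : HasFDerivAt Ψ (e : E →L[ℝ] E) x :=
    (hΨ.differentiable (by norm_num) x).hasFDerivAt
  have hs : HasStrictFDerivAt Ψ (e : E →L[ℝ] E) x :=
    hΨ.contDiffAt.hasStrictFDerivAt' he (by norm_num)
  have hr := hs.eventually_right_inverse
  have hΦ : ∀ᶠ q in 𝓝 (Ψ x), Φ q = hs.localInverse Ψ e x q := by
    filter_upwards [hr] with q hq
    conv_lhs => rw [← hq, hl]
  constructor
  · exact (hΨ.contDiffAt.to_localInverse he (by norm_num)).congr_of_eventuallyEq hΦ
  · filter_upwards [hr, hΦ] with q hq hq'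
    rw [hq', hq]

theorem eventually_posDef_of_eventually_eq {n : ℕ} {Φ Ψ : Low n → Low n}
    (hpos : ∀ x, (symOf (Ψ x)).PosDef) {p : Low n} (h : ∀ᶠ q in 𝓝 p, Ψ (Φ q) = q) :
    ∀ᶠ q in 𝓝 p, (symOf q).PosDef := by
  filter_upwards [h] with q hq
  rw [← hq]
  exact hpos _

/-- A bilinear form on coordinates as a continuous bilinear form. -/
def continuousBilin {n : ℕ} (b : Low n →ₗ[ℝ] Low n →ₗ[ℝ] ℝ) : Low n →L[ℝ] Low n →L[ℝ] ℝ :=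
  LinearMap.toContinuousLinearMap
    ((LinearMap.toContinuousLinearMap : (Low n →ₗ[ℝ] ℝ) ≃ₗ[ℝ] (Low n →L[ℝ] ℝ)).toLinearMap ∘ₗ b)

/-- A smooth bijective parametrization of the SPD matrices with injective differential
in which the metric is a definite constant form defines a flat chart. -/
def FlatChart.ofParametrization {n : ℕ} {g : Mat n → Mat n → Mat n → ℝ}
    (b : Low n →ₗ[ℝ] Low n →ₗ[ℝ] ℝ) (Φ Ψ : Low n → Low n)
    (b_comm : ∀ x y, b x y = b y x) (b_def : ∀ x, b x x = 0 → x = 0)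
    (posDef : ∀ x, (symOf (Ψ x)).PosDef) (left_inv : ∀ x, Φ (Ψ x) = x)
    (right_inv : ∀ p : Low n, (symOf p).PosDef → Ψ (Φ p) = p)
    (contDiff : ContDiff ℝ 2 Ψ) (inj : ∀ x v, fderiv ℝ Ψ x v = 0 → v = 0)
    (map_one : Φ (coords 1) = 0)
    -- The vector `v'` is described both as a derivative of `Φ` and as a preimage under `DΨ`: the
    -- Log-Euclidean chart uses the first description, the Log-Cholesky chart the second.
    (metric_eq : ∀ x v w v' w' : Low n,
      HasDerivAt (fun t : ℝ => Φ (Ψ x + t • v)) v' 0 →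
      HasDerivAt (fun t : ℝ => Φ (Ψ x + t • w)) w' 0 →
      fderiv ℝ Ψ x v' = v → fderiv ℝ Ψ x w' = w →
      g (symOf (Ψ x)) (symOf v) (symOf w) = b v' w') : FlatChart g where
  B := continuousBilin b
  Φ := Φ
  Ψ := Ψ
  B_comm := b_comm
  B_nondeg := fun x h => b_def x (h x)
  posDef := posDef
  left_inv := left_inv
  right_inv := right_inv
  contDiffAt := fun p hp => by
    have := (contDiffAt_leftInverse left_inv contDiff (Φ p) (inj _)).1
    rwa [right_inv p hp] at this
  contDiff := contDiff
  map_one := map_one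
  eventually_posDef := fun p hp => by
    have := (contDiffAt_leftInverse left_inv contDiff (Φ p) (inj _)).2
    rw [right_inv p hp] at this
    exact eventually_posDef_of_eventually_eq posDef this
  metric_eq := fun p v w hp => by
    obtain ⟨h1, h2⟩ := contDiffAt_leftInverse left_inv contDiff (Φ p) (inj _)
    rw [right_inv p hp] at h1 h2
    have hΦ : HasFDerivAt Φ (fderiv ℝ Φ p) p := (h1.differentiableAt (by norm_num)).hasFDerivAt
    have hΨ : HasFDerivAt Ψ (fderiv ℝ Ψ (Φ p)) (Φ p) :=
      (contDiff.differentiable (by norm_num) _).hasFDerivAt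
    have hd (u : Low n) : HasDerivAt (fun t : ℝ => Φ (p + t • u)) (fderiv ℝ Φ p u) 0 := by
      refine HasFDerivAt.comp_hasDerivAt (f := fun t : ℝ => p + t • u) (0 : ℝ) ?_
        (hasDerivAt_line p u 0)
      simpa using hΦ
    have hi (u : Low n) : fderiv ℝ Ψ (Φ p) (fderiv ℝ Φ p u) = u := by
      have h3 : HasFDerivAt (Ψ ∘ Φ) (ContinuousLinearMap.id ℝ (Low n)) p :=
        (hasFDerivAt_id p).congr_of_eventuallyEq h2
      exact DFunLike.congr_fun ((hΨ.comp p hΦ).unique h3) u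
    have := metric_eq (Φ p) v w _ _ (by rw [right_inv p hp]; exact hd v)
      (by rw [right_inv p hp]; exact hd w) (hi v) (hi w)
    rw [right_inv p hp] at this
    exact this

/-! ### The Log-Euclidean geometry -/

section Banach

variable {A : Type*} [NormedRing A] [NormedAlgebra ℝ A] [CompleteSpace A]

theorem hasFDerivAt_exp_fderiv (X : A) : HasFDerivAt exp (fderiv ℝ exp X) X :=
  (NormedSpace.exp_analytic (𝕂 := ℝ) X).differentiableAt.hasFDerivAt

theorem hasDerivAt_exp_line (X Y : A) :
    HasDerivAt (fun t : ℝ => exp (X + t • Y)) (fderiv ℝ exp X Y) 0 := by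
  refine HasFDerivAt.comp_hasDerivAt (f := fun t : ℝ => X + t • Y) (0 : ℝ) ?_
    (hasDerivAt_line X Y 0)
  simpa using hasFDerivAt_exp_fderiv X

/-- Differentiate `(X + tY) exp(X + tY) = exp(X + tY) (X + tY)` at `t = 0`; the terms containing the
derivative of `exp` vanish. -/
theorem commute_exp_of_fderiv_exp_eq_zero {X Y : A} (h : fderiv ℝ exp X Y = 0) :
    Commute Y (exp X) := by
  have h1 := hasDerivAt_exp_line X Y
  have h2 := (hasDerivAt_line X Y 0).mul h1
  have h3 := h1.mul (hasDerivAt_line X Y 0)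
  have e : ((fun t : ℝ => X + t • Y) * fun t : ℝ => exp (X + t • Y)) =
      (fun t : ℝ => exp (X + t • Y)) * fun t : ℝ => X + t • Y := by
    funext t
    exact ((Commute.refl (X + t • Y)).exp_right).eq
  rw [e] at h2
  have h4 := h2.unique h3
  rw [Commute, SemiconjBy]
  simpa [h] using h4

theorem fderiv_exp_of_commute {X Y : A} (h : Commute X Y) :
    fderiv ℝ exp X Y = exp X * Y := by
  let +nondep : NormedAlgebra ℚ A := .restrictScalars ℚ ℝ A
  have h1 := hasDerivAt_exp_line X Y
  have h2 := (hasDerivAt_exp_smul_const Y (0 : ℝ)).const_mul (exp X)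
  have e : (fun t : ℝ => exp (X + t • Y)) = fun t : ℝ => exp X * exp (t • Y) :=
    funext fun t => NormedSpace.exp_add_of_commute (h.smul_right t)
  rw [e] at h1
  simpa using h1.unique h2

/-- Once `Y` commutes with `X`, the derivative is `exp X * Y`, and `exp X` is invertible. The
hypothesis `hc` lets commutation pass from `exp X` to `X`. -/
theorem eq_zero_of_fderiv_exp_eq_zero {X Y : A} (h : fderiv ℝ exp X Y = 0)
    (hc : Commute Y (exp X) → Commute Y X) : Y = 0 := by
  let +nondep : NormedAlgebra ℚ A := .restrictScalars ℚ ℝ A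
  have h1 := fderiv_exp_of_commute (hc (commute_exp_of_fderiv_exp_eq_zero h)).symm
  rw [h] at h1
  exact (NormedSpace.isUnit_exp X).mul_right_eq_zero.1 h1.symm

theorem contDiff_comp_exp_comp [FiniteDimensional ℝ A] {E F : Type*} [NormedAddCommGroup E]
    [NormedSpace ℝ E] [FiniteDimensional ℝ E] [NormedAddCommGroup F] [NormedSpace ℝ F]
    (κ : A →ₗ[ℝ] F) (σ : E →ₗ[ℝ] A) : ContDiff ℝ 2 (fun x => κ (exp (σ x))) := by
  have h : ContDiff ℝ 2 (exp : A → A) :=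
    contDiff_iff_contDiffAt.2 fun X => (NormedSpace.exp_analytic (𝕂 := ℝ) X).contDiffAt
  exact (LinearMap.toContinuousLinearMap κ).contDiff.comp
    (h.comp (LinearMap.toContinuousLinearMap σ).contDiff)

end Banach

/-- `symOf` as a linear map. -/
def symOfLinear (n : ℕ) : Low n →ₗ[ℝ] Mat n where
  toFun := symOf
  map_add' := symOf_add
  map_smul' := symOf_smul

/-- `coords` as a linear map. -/
def coordsLinear (n : ℕ) : Mat n →ₗ[ℝ] Low n where
  toFun := coords
  map_add' _ _ := rfl
  map_smul' _ _ := rfl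

section Normed

attribute [local instance] Matrix.linftyOpNormedRing Matrix.linftyOpNormedAlgebra

theorem contDiff_exp_symOf (n : ℕ) : ContDiff ℝ 2 fun x : Low n => coords (exp (symOf x)) :=
  contDiff_comp_exp_comp (A := Mat n) (coordsLinear n) (symOfLinear n)

theorem exists_hasDerivAt_exp_line {n : ℕ} (X Y : Mat n) : ∃ Z : Mat n,
    HasDerivAt (fun t : ℝ => exp (X + t • Y)) Z 0 ∧
      (Z = 0 → (Commute Y (exp X) → Commute Y X) → Y = 0) :=
  ⟨fderiv ℝ exp X Y, hasDerivAt_exp_line X Y, eq_zero_of_fderiv_exp_eq_zero⟩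

end Normed

theorem fderiv_exp_symOf_injective {n : ℕ} (x v : Low n)
    (h : fderiv ℝ (fun x : Low n => coords (exp (symOf x))) x v = 0) : v = 0 := by
  obtain ⟨Z, hZ, hinj⟩ := exists_hasDerivAt_exp_line (symOf x) (symOf v)
  have e : (fun t : ℝ => coords (exp (symOf x + t • symOf v))) =
      fun t : ℝ => coords (exp (symOf (x + t • v))) :=
    funext fun t => by rw [symOf_add, symOf_smul]
  have h1 := hasDerivAt_coords hZ
  rw [e] at h1
  have h2 : HasDerivAt (fun t : ℝ => coords (exp (symOf (x + t • v)))) _ 0 :=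
    HasFDerivAt.comp_hasDerivAt (f := fun t : ℝ => x + t • v)
      (0 : ℝ)
      ((contDiff_exp_symOf n).differentiable (by norm_num) _).hasFDerivAt (hasDerivAt_line x v 0)
  have h3 := h1.unique h2
  rw [zero_smul, add_zero, h] at h3
  have hZs : Z.IsSymm := isSymm_of_hasDerivAt hZ fun s => by
    rw [← symOf_smul, ← symOf_add]
    exact (symOf_isSymm _).exp
  have hZ0 : Z = 0 := by
    rw [← symOf_coords hZs, h3]
    exact (symOfLinear n).map_zero
  -- For symmetric `X`, the matrix `X` is the functional calculus logarithm of `exp X`, so it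
  -- commutes with everything that commutes with `exp X`.
  have hv := hinj hZ0 fun hc => by
    have := (hc.symm.cfc_real Real.log).symm
    have e2 : cfc Real.log (exp (symOf x)) = symOf x := logm_exp (symOf_isSymm x)
    rwa [e2] at this
  rw [← coords_symOf v, hv]
  rfl

/-- The Frobenius inner product in coordinates. -/
def frobBilin (n : ℕ) : Low n →ₗ[ℝ] Low n →ₗ[ℝ] ℝ :=
  LinearMap.mk₂ ℝ (fun x y => frob (symOf x) (symOf y))
    (fun _ _ _ => by simp [frob, symOf_add, add_mul])
    (fun _ _ _ => by simp [frob, symOf_smul])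
    (fun _ _ _ => by simp [frob, symOf_add, mul_add])
    (fun _ _ _ => by simp [frob, symOf_smul])

theorem frob_comm {n : ℕ} (A B : Mat n) : frob A B = frob B A := by
  rw [frob, frob, ← trace_transpose, transpose_mul, transpose_transpose]

theorem eq_zero_of_frob_self {n : ℕ} {A : Mat n} (h : frob A A = 0) : A = 0 := by
  rw [frob, ← conjTranspose_eq_transpose_of_trivial] at h
  exact Matrix.trace_conjTranspose_mul_self_eq_zero_iff.1 h

theorem hasDerivAt_logm_line {n : ℕ} {p v v' : Low n}
    (h : HasDerivAt (fun t : ℝ => coords (logm (symOf (p + t • v)))) v' 0) :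
    Dlogm (symOf p) (symOf v) = symOf v' := by
  have h1 := hasDerivAt_symOf h
  have e : (fun t : ℝ => symOf (coords (logm (symOf (p + t • v))))) =
      fun t : ℝ => logm (symOf p + t • symOf v) := by
    funext t
    rw [symOf_coords (logm_isSymm _), symOf_add, symOf_smul]
  rw [e] at h1
  exact deriv_matrix h1

theorem logm_one (n : ℕ) : logm (1 : Mat n) = 0 := by
  have h := logm_exp (A := (0 : Mat n)) (by simp [IsSymm])
  rwa [NormedSpace.exp_zero] at h

/-- The matrix logarithm is a flat chart of the Log-Euclidean geometry. -/
def flatChartLE (n : ℕ) : FlatChart (metricLE (n := n)) :=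
  .ofParametrization (frobBilin n) (fun p => coords (logm (symOf p)))
    (fun x => coords (exp (symOf x)))
    (fun _ _ => frob_comm _ _)
    (fun x h => by
      have h1 : symOf x = 0 := eq_zero_of_frob_self h
      rw [← coords_symOf x, h1]
      rfl)
    (fun x => by
      rw [symOf_coords (symOf_isSymm x).exp]
      exact posDef_exp (symOf_isSymm x))
    (fun x => by rw [symOf_coords (symOf_isSymm x).exp, logm_exp (symOf_isSymm x), coords_symOf])
    (fun p hp => by rw [symOf_coords (logm_isSymm _), exp_logm hp, coords_symOf])
    (contDiff_exp_symOf n) fderiv_exp_symOf_injective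
    (by
      rw [symOf_coords isSymm_one, logm_one]
      rfl)
    (fun x v w v' w' hv hw _ _ => by
      rw [metricLE, hasDerivAt_logm_line hv, hasDerivAt_logm_line hw]
      rfl)

/-! ### The Cholesky factorization -/

/-- Lower triangular matrices. -/
abbrev IsLower {n : ℕ} (A : Mat n) : Prop := A.BlockTriangular OrderDual.toDual

theorem IsLower.apply_eq_zero {n : ℕ} {A : Mat n} (h : IsLower A) {i j : Fin n} (hij : i < j) :
    A i j = 0 := h (OrderDual.toDual_lt_toDual.2 hij)

theorem IsLower.inv {n : ℕ} {A : Mat n} (h : IsLower A) (hA : IsUnit A) : IsLower A⁻¹ := by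
  have := hA.invertible
  exact blockTriangular_inv_of_blockTriangular h

theorem IsCholesky.isLower {n : ℕ} {L P : Mat n} (h : IsCholesky L P) : IsLower L :=
  fun i j hij => h.1 i j (OrderDual.toDual_lt_toDual.1 hij)

theorem IsLower.isUnit_iff {n : ℕ} {L : Mat n} (h : IsLower L) : IsUnit L ↔ ∀ i, L i i ≠ 0 := by
  rw [Matrix.isUnit_iff_isUnit_det, det_of_isLowerTriangular L h, isUnit_iff_ne_zero,
    Finset.prod_ne_zero_iff]
  simp

theorem IsCholesky.isUnit {n : ℕ} {L P : Mat n} (h : IsCholesky L P) : IsUnit L :=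
  h.isLower.isUnit_iff.2 fun i => (h.2.1 i).ne'

/-- The matrix `K⁻¹ L` is lower triangular and orthogonal, so its transpose, being its inverse, is
lower triangular too. It is therefore diagonal, with positive entries of square one. -/
theorem IsCholesky.unique {n : ℕ} {L K P : Mat n} (hL : IsCholesky L P) (hK : IsCholesky K P) :
    L = K := by
  have hKd : IsUnit K.det := (Matrix.isUnit_iff_isUnit_det K).1 hK.isUnit
  have hLd : IsUnit L.det := (Matrix.isUnit_iff_isUnit_det L).1 hL.isUnit
  set M := K⁻¹ * L with hM
  have hKM : K * M = L := by rw [hM, mul_nonsing_inv_cancel_left _ _ hKd]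
  have hMM : M * Mᵀ = 1 := by
    have : L * Lᵀ = K * Kᵀ := hL.2.2.symm.trans hK.2.2
    rw [hM, transpose_mul, transpose_nonsing_inv, Matrix.mul_assoc, ← Matrix.mul_assoc L,
      this, Matrix.mul_assoc, mul_nonsing_inv _ (by rwa [det_transpose]), Matrix.mul_one,
      nonsing_inv_mul _ hKd]
  have hMl : IsLower M := (hK.isLower.inv hK.isUnit).mul hL.isLower
  have hMu : IsLower Mᵀ := by
    rw [← inv_eq_right_inv hMM]
    exact hMl.inv (IsUnit.of_mul_eq_one _ hMM)
  have hMd : M = diagonal fun i => M i i := by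
    ext i j
    rcases lt_trichotomy i j with h | h | h
    · rw [hMl.apply_eq_zero h, diagonal_apply_ne _ h.ne]
    · subst h; simp
    · rw [diagonal_apply_ne _ h.ne']
      exact hMu.apply_eq_zero h
  have hM1 (i) : M i i = 1 := by
    have h1 : L i i = K i i * M i i := by
      rw [← hKM, hMd]
      simp [mul_diagonal]
    have h2 : 0 < M i i := by
      have := hL.2.1 i
      rw [h1] at this
      exact (pos_iff_pos_of_mul_pos this).1 (hK.2.1 i)
    have h3 : M i i * M i i = 1 := by
      have := congrFun (congrFun hMM i) i
      rw [hMd] at this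
      simpa using this
    nlinarith
  rw [← hKM, hMd]
  simp [hM1]

theorem exists_isCholesky {n : ℕ} {P : Mat n} (hP : P.PosDef) : ∃ L, IsCholesky L P := by
  set A := LDL.lower hP with hA
  have hinv : IsUnit (LDL.lowerInv hP) := isUnit_of_invertible _
  have hAl : IsLower A := by
    have : IsLower (LDL.lowerInv hP) := fun i j hij =>
      LDL.lowerInv_triangular hP (OrderDual.toDual_lt_toDual.1 hij)
    exact this.inv hinv
  have hAu : IsUnit A := by
    rw [hA, LDL.lower]
    exact (Matrix.isUnit_nonsing_inv_iff).2 hinv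
  have hd : ∀ i, 0 < LDL.diagEntries hP i := by
    have := posDef_mul_mul_transpose hP hinv
    rw [← conjTranspose_eq_transpose_of_trivial, ← LDL.diag_eq_lowerInv_conj hP, LDL.diag,
      posDef_diagonal_iff] at this
    exact this
  -- The sign makes the diagonal of `A * diagonal d` positive whatever the signs of the diagonal of
  -- `A`, and leaves the squares `d i * d i` unchanged.
  let d : Fin n → ℝ := fun i => SignType.sign (A i i) * Real.sqrt (LDL.diagEntries hP i)
  have hdd : (fun i => d i * d i) = LDL.diagEntries hP := by
    funext i
    have h1 := hAl.isUnit_iff.1 hAu i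
    have h2 := Real.mul_self_sqrt (hd i).le
    rcases lt_or_gt_of_ne h1 with h | h
    · simp [d, sign_neg h, h2]
    · simp [d, sign_pos h, h2]
  refine ⟨A * diagonal d, fun i j hij => ?_, fun i => ?_, ?_⟩
  · simp [mul_diagonal, hAl.apply_eq_zero hij]
  · rw [mul_diagonal]
    have h1 := hAl.isUnit_iff.1 hAu i
    have h2 := Real.sqrt_pos.2 (hd i)
    rcases lt_or_gt_of_ne h1 with h | h
    · simp only [d, sign_neg h]
      have := mul_pos (neg_pos.2 h) h2
      simpa using this
    · simp only [d, sign_pos h]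
      have := mul_pos h h2
      simpa using this
  · conv_lhs => rw [← LDL.lower_conj_diag hP]
    have e : LDL.diag hP = diagonal d * diagonal d := by
      rw [diagonal_mul_diagonal, hdd]; rfl
    rw [transpose_mul, diagonal_transpose, e, conjTranspose_eq_transpose_of_trivial]
    simp only [Matrix.mul_assoc, hA]

theorem isCholesky_cholesky {n : ℕ} {P : Mat n} (hP : P.PosDef) : IsCholesky (cholesky P) P :=
  Classical.epsilon_spec (exists_isCholesky hP)

theorem IsCholesky.cholesky_eq {n : ℕ} {L P : Mat n} (h : IsCholesky L P) : cholesky P = L :=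
  IsCholesky.unique (Classical.epsilon_spec (p := fun K => IsCholesky K P) ⟨L, h⟩) h

theorem IsCholesky.posDef {n : ℕ} {L P : Mat n} (h : IsCholesky L P) : P.PosDef := by
  have := posDef_mul_mul_transpose PosDef.one h.isUnit
  rwa [mul_one, ← h.2.2] at this

theorem lowerHalf_add_transpose {n : ℕ} {M : Mat n} (h : IsLower M) :
    lowerHalf (M + Mᵀ) = M := by
  ext i j
  rcases lt_trichotomy i j with hij | hij | hij
  · simp [lowerHalf, hij.not_gt, hij.ne, h.apply_eq_zero hij]
  · subst hij
    simp [lowerHalf]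
  · simp [lowerHalf, hij, h.apply_eq_zero hij]

/-- With `M = L⁻¹ X`, which is lower triangular, conjugating by `L⁻¹` turns the argument into `M +
Mᵀ`, from which `lowerHalf` recovers `M`. Thus the formula for `Dcholesky` inverts the differential
of `L ↦ L Lᵀ`. -/
theorem IsCholesky.Dcholesky_eq {n : ℕ} {L P X : Mat n} (h : IsCholesky L P) (hX : IsLower X) :
    Dcholesky P (X * Lᵀ + L * Xᵀ) = X := by
  have hLd : IsUnit L.det := (Matrix.isUnit_iff_isUnit_det L).1 h.isUnit
  have hLd' : IsUnit Lᵀ.det := by rwa [det_transpose]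
  have e : L⁻¹ * (X * Lᵀ + L * Xᵀ) * (L⁻¹)ᵀ = L⁻¹ * X + (L⁻¹ * X)ᵀ := by
    rw [transpose_mul, transpose_nonsing_inv, Matrix.mul_add, Matrix.add_mul,
      nonsing_inv_mul_cancel_left _ _ hLd, ← Matrix.mul_assoc, mul_nonsing_inv_cancel_right _ _ hLd']
  rw [Dcholesky, h.cholesky_eq, e, lowerHalf_add_transpose ((h.isLower.inv h.isUnit).mul hX),
    mul_nonsing_inv_cancel_left _ _ hLd]

/-! ### The Log-Cholesky geometry -/

/-- The lower triangular matrix with given entries on and below the diagonal. -/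
def lowOf {n : ℕ} (x : Low n) : Mat n :=
  Matrix.of fun i j => if h : j ≤ i then x ⟨(i, j), h⟩ else 0

theorem isLower_lowOf {n : ℕ} (x : Low n) : IsLower (lowOf x) := fun i j hij => by
  simp [lowOf, (OrderDual.toDual_lt_toDual.1 hij).not_ge]

@[simp] theorem coords_lowOf {n : ℕ} (x : Low n) : coords (lowOf x) = x := by
  funext ⟨⟨i, j⟩, h⟩
  have h' : j ≤ i := h
  simp [coords, lowOf, h']

theorem lowOf_coords {n : ℕ} {A : Mat n} (h : IsLower A) : lowOf (coords A) = A := by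
  ext i j
  by_cases hij : j ≤ i
  · simp [lowOf, coords, hij]
  · simp [lowOf, hij, h.apply_eq_zero (not_le.1 hij)]

theorem hasDerivAt_lowOf {n : ℕ} {f : ℝ → Low n} {f' : Low n} {t : ℝ} (h : HasDerivAt f f' t) :
    HasDerivAt (fun s => lowOf (f s)) (lowOf f') t := by
  refine hasDerivAt_matrix.2 fun i j => ?_
  by_cases hij : j ≤ i
  · simpa [lowOf, hij] using hasDerivAt_pi.1 h _
  · simpa [lowOf, hij] using hasDerivAt_const t (0 : ℝ)

/-- The coordinates with the diagonal ones exponentiated. -/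
def expDiag {n : ℕ} (x : Low n) : Low n := fun p =>
  if p.1.1 = p.1.2 then Real.exp (x p) else x p

/-- The coordinates with the logarithm applied to the diagonal ones. -/
def logDiag {n : ℕ} (x : Low n) : Low n := fun p =>
  if p.1.1 = p.1.2 then Real.log (x p) else x p

/-- The differential of `expDiag`. -/
def dexpDiag {n : ℕ} (x v : Low n) : Low n := fun p =>
  if p.1.1 = p.1.2 then Real.exp (x p) * v p else v p

@[simp] theorem logDiag_expDiag {n : ℕ} (x : Low n) : logDiag (expDiag x) = x := by
  funext p
  by_cases h : p.1.1 = p.1.2 <;> simp [logDiag, expDiag, h]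

theorem expDiag_logDiag_coords {n : ℕ} {L : Mat n} (h : ∀ i, 0 < L i i) :
    expDiag (logDiag (coords L)) = coords L := by
  funext ⟨⟨i, j⟩, hij⟩
  by_cases e : i = j
  · subst e
    simp [logDiag, expDiag, coords, Real.exp_log (h i)]
  · simp [logDiag, expDiag, e]

/-- The lower triangular matrix with positive diagonal with given logarithmic coordinates. -/
def cholOf {n : ℕ} (x : Low n) : Mat n := lowOf (expDiag x)

theorem isCholesky_cholOf {n : ℕ} (x : Low n) : IsCholesky (cholOf x) (cholOf x * (cholOf x)ᵀ) :=
  ⟨fun _ _ hij => (isLower_lowOf _).apply_eq_zero hij,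
    fun i => by simp [cholOf, lowOf, expDiag, Real.exp_pos], rfl⟩

theorem hasDerivAt_cholOf_line {n : ℕ} (x v : Low n) :
    HasDerivAt (fun t : ℝ => cholOf (x + t • v)) (lowOf (dexpDiag x v)) 0 := by
  refine hasDerivAt_lowOf (hasDerivAt_pi.2 fun p => ?_)
  have h := hasDerivAt_pi.1 (hasDerivAt_line x v 0) p
  by_cases e : p.1.1 = p.1.2
  · simp only [expDiag, dexpDiag, e, if_true]
    simpa using h.exp
  · simpa only [expDiag, dexpDiag, e, if_false] using h

/-- The parametrization of the SPD matrices by logarithmic Cholesky coordinates. -/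
def cholParam {n : ℕ} (x : Low n) : Low n := coords (cholOf x * (cholOf x)ᵀ)

theorem symOf_cholParam {n : ℕ} (x : Low n) : symOf (cholParam x) = cholOf x * (cholOf x)ᵀ :=
  symOf_coords (by rw [IsSymm, transpose_mul, transpose_transpose])

theorem contDiff_cholParam (n : ℕ) : ContDiff ℝ 2 (cholParam (n := n)) := by
  have h (i j : Fin n) : ContDiff ℝ 2 fun x : Low n => cholOf x i j := by
    by_cases hij : j ≤ i
    · by_cases e : i = j
      · subst e
        simp only [cholOf, lowOf, expDiag, of_apply, le_refl, dite_true, if_true]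
        fun_prop
      · simp only [cholOf, lowOf, expDiag, of_apply, hij, e, dite_true, if_false]
        fun_prop
    · simp only [cholOf, lowOf, of_apply, hij, dite_false]
      fun_prop
  refine contDiff_pi.2 fun p => ?_
  simp only [cholParam, coords, mul_apply, transpose_apply]
  exact ContDiff.sum fun k _ => (h _ k).mul (h _ k)

theorem fderiv_cholParam {n : ℕ} (x v : Low n) : symOf (fderiv ℝ cholParam x v) =
    lowOf (dexpDiag x v) * (cholOf x)ᵀ + cholOf x * (lowOf (dexpDiag x v))ᵀ := by
  have h1 := hasDerivAt_coords (hasDerivAt_matrix_mul (hasDerivAt_cholOf_line x v)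
    (hasDerivAt_matrix_transpose (hasDerivAt_cholOf_line x v)))
  simp only [zero_smul, add_zero] at h1
  have h2 : HasDerivAt (fun t : ℝ => cholParam (x + t • v)) _ 0 :=
    HasFDerivAt.comp_hasDerivAt (f := fun t : ℝ => x + t • v) (0 : ℝ)
      ((contDiff_cholParam n).differentiable (by norm_num) _).hasFDerivAt (hasDerivAt_line x v 0)
  simp only [zero_smul, add_zero] at h2
  rw [h2.unique h1, symOf_coords]
  rw [IsSymm, transpose_add, transpose_mul, transpose_mul, transpose_transpose,
    transpose_transpose, add_comm]

theorem Dcholesky_fderiv_cholParam {n : ℕ} (x v : Low n) :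
    Dcholesky (symOf (cholParam x)) (symOf (fderiv ℝ cholParam x v)) = lowOf (dexpDiag x v) := by
  rw [fderiv_cholParam, symOf_cholParam, (isCholesky_cholOf x).Dcholesky_eq (isLower_lowOf _)]

theorem dexpDiag_eq_zero {n : ℕ} {x v : Low n} (h : dexpDiag x v = 0) : v = 0 := by
  funext p
  have := congrFun h p
  by_cases e : p.1.1 = p.1.2
  · simpa [dexpDiag, e, Real.exp_ne_zero] using this
  · simpa [dexpDiag, e] using this

theorem Dcholesky_zero {n : ℕ} (P : Mat n) : Dcholesky P 0 = 0 := by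
  have : lowerHalf (0 : Mat n) = 0 := by
    ext i j
    simp [lowerHalf]
  simp [Dcholesky, this]

/-- The Log-Cholesky metric in logarithmic coordinates. -/
def lowBilin (n : ℕ) : Low n →ₗ[ℝ] Low n →ₗ[ℝ] ℝ :=
  LinearMap.mk₂ ℝ (fun x y => ∑ p, x p * y p)
    (fun _ _ _ => by simp [add_mul, Finset.sum_add_distrib])
    (fun _ _ _ => by simp [Finset.mul_sum, mul_assoc])
    (fun _ _ _ => by simp [mul_add, Finset.sum_add_distrib])
    (fun _ _ _ => by simp [Finset.mul_sum, mul_left_comm])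

/-- On the diagonal, the two factors `exp (x i i)` brought in by differentiating the exponential
cancel the weight `L i i ^ (-2)`, so the metric becomes constant. -/
theorem metricLower_cholOf {n : ℕ} (x v w : Low n) :
    metricLower (cholOf x) (lowOf (dexpDiag x v)) (lowOf (dexpDiag x w)) = lowBilin n v w := by
  have h1 : lowBilin n v w = ∑ i, ∑ j, if h : j ≤ i then v ⟨(i, j), h⟩ * w ⟨(i, j), h⟩ else 0 := by
    let F : Fin n × Fin n → ℝ := fun q =>
      if h : q.2 ≤ q.1 then v ⟨(q.1, q.2), h⟩ * w ⟨(q.1, q.2), h⟩ else 0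
    have h2 : ∑ q, F q = ∑ i, ∑ j, F (i, j) := Fintype.sum_prod_type F
    refine Eq.trans ?_ h2
    have h3 : ∑ q ∈ Finset.univ.filter (fun q : Fin n × Fin n => q.2 ≤ q.1), F q =
        ∑ p : {q : Fin n × Fin n // q.2 ≤ q.1}, F p :=
      Finset.sum_subtype _ (by simp) F
    rw [Finset.sum_filter] at h3
    rw [show lowBilin n v w = ∑ p, v p * w p from rfl]
    refine (Finset.sum_congr rfl fun p _ => ?_).trans
      (h3.symm.trans (Finset.sum_congr rfl fun q _ => ?_))
    · simp [F, p.2]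
    · by_cases hq : q.2 ≤ q.1 <;> simp [F, hq]
  rw [h1, metricLower, ← Finset.sum_add_distrib]
  refine Finset.sum_congr rfl fun i _ => ?_
  -- The diagonal term is spread over a sum in `j`, so that both sides can be compared entry by
  -- entry.
  have h2 : lowOf (dexpDiag x v) i i * lowOf (dexpDiag x w) i i / cholOf x i i ^ 2 =
      ∑ j, if j = i then lowOf (dexpDiag x v) i i * lowOf (dexpDiag x w) i i / cholOf x i i ^ 2
        else 0 := by simp
  rw [h2, ← Finset.sum_add_distrib]
  refine Finset.sum_congr rfl fun j _ => ?_
  rcases lt_trichotomy i j with h | h | h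
  · simp [h.not_ge, h.not_gt, h.ne']
  · subst h
    have := Real.exp_ne_zero (x ⟨(i, i), le_refl i⟩)
    simp [lowOf, dexpDiag, cholOf, expDiag]
    field_simp
  · simp [h, h.le, h.ne, h.ne', lowOf, dexpDiag]

/-- The logarithmic Cholesky factor is a flat chart of the Log-Cholesky geometry. -/
def flatChartLC (n : ℕ) : FlatChart (metricLC (n := n)) :=
  .ofParametrization (lowBilin n) (fun p => logDiag (coords (cholesky (symOf p)))) cholParam
    (fun x y => by simp [lowBilin, mul_comm])
    (fun x h => by
      have h1 : ∑ p, x p * x p = 0 := h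
      rw [Finset.sum_eq_zero_iff_of_nonneg fun _ _ => mul_self_nonneg _] at h1
      funext p
      exact mul_self_eq_zero.1 (h1 p (Finset.mem_univ p)))
    (fun x => by
      rw [symOf_cholParam]
      exact (isCholesky_cholOf x).posDef)
    (fun x => by
      rw [symOf_cholParam, (isCholesky_cholOf x).cholesky_eq, cholOf, coords_lowOf,
        logDiag_expDiag])
    (fun p hp => by
      have h := isCholesky_cholesky hp
      rw [cholParam, cholOf, expDiag_logDiag_coords h.2.1, lowOf_coords h.isLower, ← h.2.2,
        coords_symOf])
    (contDiff_cholParam n)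
    (fun x v h => by
      have h1 := Dcholesky_fderiv_cholParam x v
      rw [h, show symOf (0 : Low n) = 0 from (symOfLinear n).map_zero, Dcholesky_zero] at h1
      refine dexpDiag_eq_zero (x := x) ?_
      rw [← coords_lowOf (dexpDiag x v), ← h1]
      rfl)
    (by
      have h : IsCholesky (1 : Mat n) 1 :=
        ⟨fun i j hij => one_apply_ne hij.ne, fun i => by simp, by simp⟩
      rw [symOf_coords isSymm_one, h.cholesky_eq]
      funext ⟨⟨i, j⟩, hij⟩
      by_cases e : i = j
      · subst e
        simp [logDiag, coords]
      · simp [logDiag, coords, e])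
    (fun x v w v' w' _ _ hv hw => by
      rw [← hv, ← hw, metricLC, Dcholesky_fderiv_cholParam, Dcholesky_fderiv_cholParam,
        symOf_cholParam, (isCholesky_cholOf x).cholesky_eq, metricLower_cholOf])

/-! ### The Affine-Invariant geometry -/

theorem isUnit_det_of_posDef {n : ℕ} {P : Mat n} (hP : P.PosDef) : IsUnit P.det :=
  (Matrix.isUnit_iff_isUnit_det P).1 hP.isUnit

theorem metricDeriv_metricAI {n : ℕ} {P : Mat n} (hP : P.PosDef) (U V W : Mat n) :
    metricDeriv metricAI P U V W =
      -(P⁻¹ * U * (P⁻¹ * V) * (P⁻¹ * W)).trace - (P⁻¹ * V * (P⁻¹ * U) * (P⁻¹ * W)).trace := by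
  have h0 : HasDerivAt (fun t : ℝ => P + t • U) U 0 :=
    hasDerivAt_matrix.2 fun i j => hasDerivAt_line (P i j) (U i j) 0
  have hi := hasDerivAt_matrix_inv h0 (by simpa using hP.isUnit)
  have hc (C : Mat n) : HasDerivAt (fun _ : ℝ => C) 0 0 :=
    hasDerivAt_matrix.2 fun i j => hasDerivAt_const (0 : ℝ) (C i j)
  have h1 := hasDerivAt_matrix_trace (hasDerivAt_matrix_mul (hasDerivAt_matrix_mul
    (hasDerivAt_matrix_mul hi (hc V)) hi) (hc W))
  refine h1.deriv.trans ?_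
  simp only [zero_smul, add_zero, Matrix.mul_zero, ← trace_neg, ← trace_sub]
  congr 1
  noncomm_ring

/-- By cyclicity of the trace, all six terms are traces of one of the two cyclic orders of `U`, `V`,
`Z`; after cancellation one copy of each remains, halved. -/
theorem christoffel_metricAI {n : ℕ} {P : Mat n} (hP : P.PosDef) (U V Z : Mat n) :
    christoffel metricAI P U V Z =
      -(P⁻¹ * ((1 / 2 : ℝ) • (U * P⁻¹ * V + V * P⁻¹ * U)) * P⁻¹ * Z).trace := by
  rw [christoffel, metricDeriv_metricAI hP, metricDeriv_metricAI hP, metricDeriv_metricAI hP]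
  have e1 : (P⁻¹ * Z * (P⁻¹ * U) * (P⁻¹ * V)).trace = (P⁻¹ * U * (P⁻¹ * V) * (P⁻¹ * Z)).trace := by
    rw [Matrix.mul_assoc, Matrix.trace_mul_comm]
  have e2 : (P⁻¹ * U * (P⁻¹ * Z) * (P⁻¹ * V)).trace = (P⁻¹ * V * (P⁻¹ * U) * (P⁻¹ * Z)).trace := by
    rw [Matrix.trace_mul_comm]
    simp only [Matrix.mul_assoc]
  have e3 : P⁻¹ * ((1 / 2 : ℝ) • (U * P⁻¹ * V + V * P⁻¹ * U)) * P⁻¹ * Z =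
      (1 / 2 : ℝ) • (P⁻¹ * U * (P⁻¹ * V) * (P⁻¹ * Z) + P⁻¹ * V * (P⁻¹ * U) * (P⁻¹ * Z)) := by
    simp only [Matrix.mul_smul, Matrix.smul_mul, Matrix.mul_add, Matrix.add_mul, Matrix.mul_assoc]
  rw [e1, e2, e3, trace_smul, trace_add, smul_eq_mul]
  ring

theorem metricAI_add_christoffel {n : ℕ} {P : Mat n} (hP : P.PosDef) (U V V' Z : Mat n) :
    metricAI P V' Z + christoffel metricAI P U V Z =
      (P⁻¹ * (V' - (1 / 2 : ℝ) • (U * P⁻¹ * V + V * P⁻¹ * U)) * P⁻¹ * Z).trace := by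
  rw [christoffel_metricAI hP, metricAI, ← sub_eq_add_neg, ← trace_sub]
  simp only [Matrix.mul_sub, Matrix.sub_mul]

/-- Testing against `Z = P X P` gives `tr (X X) = 0`, the squared Frobenius norm of the symmetric
matrix `X`. -/
theorem eq_zero_of_metricAI_eq_zero {n : ℕ} {P X : Mat n} (hP : P.PosDef) (hX : X.IsSymm)
    (h : ∀ Z : Sym n, (P⁻¹ * X * P⁻¹ * (Z : Mat n)).trace = 0) : X = 0 := by
  have hPs := isSymm_of_posDef hP
  have hPd := isUnit_det_of_posDef hP
  have h1 := h ⟨P * X * P, by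
    rw [IsSymm, transpose_mul, transpose_mul, hPs.eq, hX.eq, Matrix.mul_assoc]⟩
  have e : P⁻¹ * X * P⁻¹ * (P * X * P) = P⁻¹ * (X * X * P) := by
    simp only [Matrix.mul_assoc, nonsing_inv_mul_cancel_left _ _ hPd]
  simp only [e] at h1
  rw [Matrix.trace_mul_comm, mul_nonsing_inv_cancel_right _ _ hPd] at h1
  refine eq_zero_of_frob_self ?_
  rw [frob, hX.eq, h1]

/-- Nondegeneracy on symmetric matrices turns the weak equation tested against all `Z` into an
explicit differential equation. -/
theorem isParallel_metricAI_iff {n : ℕ} (γ : ℝ → SPD n) (u V : ℝ → Sym n) :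
    IsParallel metricAI γ u V ↔ ∀ t, HasDerivAt (fun s => (V s : Mat n))
      ((1 / 2 : ℝ) • ((u t : Mat n) * (γ t : Mat n)⁻¹ * V t + (V t : Mat n) * (γ t : Mat n)⁻¹ * u t))
      t := by
  refine forall_congr' fun t => ⟨?_, fun h => ?_⟩
  · rintro ⟨V', hV', hZ⟩
    convert hV' using 1
    symm
    rw [← sub_eq_zero]
    refine eq_zero_of_metricAI_eq_zero (γ t).2 ?_ fun Z => ?_
    · have hi : ((γ t : Mat n)⁻¹)ᵀ = (γ t : Mat n)⁻¹ := by
        rw [transpose_nonsing_inv, (isSymm_of_posDef (γ t).2).eq]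
      simp only [IsSymm, transpose_sub, transpose_smul, transpose_add, transpose_mul, hi,
        (u t).2.eq, (V t).2.eq, V'.2.eq, Matrix.mul_assoc, add_comm]
    · rw [← metricAI_add_christoffel (γ t).2]
      exact hZ Z
  · refine ⟨⟨_, isSymm_of_hasDerivAt h fun s => (V s).2⟩, h, fun Z => ?_⟩
    rw [metricAI_add_christoffel (γ t).2]
    simp

/-- The flow `s ↦ exp (s A / 2)` through which parallel fields are transported. -/
def halfFlow {n : ℕ} (A : Mat n) (t : ℝ) : Mat n := exp (t • (1 / 2 : ℝ) • A)

theorem halfFlow_zero {n : ℕ} (A : Mat n) : halfFlow A 0 = 1 := by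
  simp [halfFlow, NormedSpace.exp_zero]

theorem isUnit_halfFlow {n : ℕ} (A : Mat n) (t : ℝ) : IsUnit (halfFlow A t) :=
  Matrix.isUnit_exp _

theorem commute_halfFlow {n : ℕ} (A : Mat n) (t : ℝ) : A * halfFlow A t = halfFlow A t * A :=
  (((Commute.refl A).smul_right _).smul_right t).exp_right.eq

theorem hasDerivAt_halfFlow_conj {n : ℕ} (A X : Mat n) (t : ℝ) :
    HasDerivAt (fun s => halfFlow A s * X * (halfFlow A s)ᵀ)
      ((1 / 2 : ℝ) • (A * (halfFlow A t * X * (halfFlow A t)ᵀ) +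
        halfFlow A t * X * (halfFlow A t)ᵀ * Aᵀ)) t := by
  have h1 : HasDerivAt (halfFlow A) ((1 / 2 : ℝ) • A * halfFlow A t) t :=
    hasDerivAt_exp_smul_matrix _ t
  have hc : HasDerivAt (fun _ : ℝ => X) 0 t :=
    hasDerivAt_matrix.2 fun i j => hasDerivAt_const t (X i j)
  have h2 := hasDerivAt_matrix_mul (hasDerivAt_matrix_mul h1 hc) (hasDerivAt_matrix_transpose h1)
  convert h2 using 1
  simp only [transpose_mul, transpose_smul, Matrix.mul_zero, add_zero, Matrix.smul_mul,
    Matrix.mul_smul, Matrix.mul_assoc, smul_add]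

theorem halfFlow_neg {n : ℕ} (A : Mat n) (t : ℝ) : halfFlow (-A) t = (halfFlow A t)⁻¹ := by
  rw [halfFlow, halfFlow, ← Matrix.exp_neg]
  simp

/-- Solutions of the linear equation `X' = (A X + X Aᵀ) / 2`. -/
theorem eq_halfFlow_conj {n : ℕ} {A : Mat n} {X : ℝ → Mat n}
    (h : ∀ t, HasDerivAt X ((1 / 2 : ℝ) • (A * X t + X t * Aᵀ)) t) (t : ℝ) :
    X t = halfFlow A t * X 0 * (halfFlow A t)ᵀ := by
  -- Variation of constants: undoing the expected flow leaves a constant curve, which gives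
  -- uniqueness.
  have hd : ∀ t, HasDerivAt (fun s => halfFlow (-A) s * X s * (halfFlow (-A) s)ᵀ) 0 t := by
    intro t
    have h1 : HasDerivAt (halfFlow (-A)) ((1 / 2 : ℝ) • (-A) * halfFlow (-A) t) t :=
      hasDerivAt_exp_smul_matrix _ t
    have h2 := hasDerivAt_matrix_mul (hasDerivAt_matrix_mul h1 (h t))
      (hasDerivAt_matrix_transpose h1)
    convert h2 using 1
    have hc : halfFlow (-A) t * A = A * halfFlow (-A) t := by
      have := commute_halfFlow (-A) t
      simpa using this.symm
    have hc' : Aᵀ * (halfFlow (-A) t)ᵀ = (halfFlow (-A) t)ᵀ * Aᵀ := by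
      rw [← transpose_mul, ← transpose_mul, hc]
    simp only [transpose_mul, transpose_smul, transpose_neg, Matrix.smul_mul, Matrix.mul_smul,
      Matrix.mul_add, Matrix.add_mul, Matrix.mul_assoc, hc', ← Matrix.mul_assoc (halfFlow (-A) t) A,
      hc, smul_add, Matrix.neg_mul, Matrix.mul_neg, smul_neg]
    abel
  have h3 := matrix_eq_of_hasDerivAt_zero hd t
  have hu : IsUnit (halfFlow A t).det := (Matrix.isUnit_iff_isUnit_det _).1 (isUnit_halfFlow A t)
  have hu' : IsUnit (halfFlow A t)ᵀ.det := by rwa [det_transpose]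
  simp only [halfFlow_zero, Matrix.one_mul, transpose_one, Matrix.mul_one, halfFlow_neg] at h3
  rw [← h3, transpose_nonsing_inv]
  simp only [Matrix.mul_assoc, nonsing_inv_mul _ hu', Matrix.mul_one,
    mul_nonsing_inv_cancel_left _ _ hu]

/-- A conservation law: the geodesic equation `u' = u γ⁻¹ u` cancels the derivative of `γ⁻¹`. With
the constant `A = u γ⁻¹`, the geodesic and all parallel fields along it solve the same linear
equation `X' = (A X + X Aᵀ) / 2`. -/
theorem velocity_metricAI {n : ℕ} {γ : ℝ → SPD n} {u : ℝ → Sym n} (h : IsGeodesic metricAI γ u)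
    (t : ℝ) : (u t : Mat n) * (γ t : Mat n)⁻¹ = (u 0 : Mat n) * (γ 0 : Mat n)⁻¹ := by
  refine matrix_eq_of_hasDerivAt_zero (f := fun t => (u t : Mat n) * (γ t : Mat n)⁻¹)
    (fun t => ?_) t
  have h1 := hasDerivAt_matrix_mul ((isParallel_metricAI_iff γ u u).1 h.2 t)
    (hasDerivAt_matrix_inv (h.1 t) (γ t).2.isUnit)
  convert h1 using 1
  rw [← two_smul ℝ, smul_smul]
  simp [Matrix.mul_assoc]

theorem parallel_metricAI {n : ℕ} {γ : ℝ → SPD n} {u V : ℝ → Sym n} (h : IsGeodesic metricAI γ u)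
    (hV : IsParallel metricAI γ u V) (t : ℝ) :
    (V t : Mat n) = halfFlow ((u 0 : Mat n) * (γ 0 : Mat n)⁻¹) t * V 0 *
      (halfFlow ((u 0 : Mat n) * (γ 0 : Mat n)⁻¹) t)ᵀ := by
  refine eq_halfFlow_conj (X := fun t => (V t : Mat n)) (fun t => ?_) t
  have h1 := (isParallel_metricAI_iff γ u V).1 hV t
  have h2 : (γ t : Mat n)⁻¹ * (u t : Mat n) = ((u 0 : Mat n) * (γ 0 : Mat n)⁻¹)ᵀ := by
    rw [← velocity_metricAI h t, transpose_mul, transpose_nonsing_inv, (u t).2.eq,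
      (isSymm_of_posDef (γ t).2).eq]
  rwa [velocity_metricAI h, Matrix.mul_assoc (V t : Mat n), h2] at h1

theorem geodesic_metricAI {n : ℕ} {γ : ℝ → SPD n} {u : ℝ → Sym n} (h : IsGeodesic metricAI γ u)
    (t : ℝ) : (γ t : Mat n) = halfFlow ((u 0 : Mat n) * (γ 0 : Mat n)⁻¹) t * γ 0 *
      (halfFlow ((u 0 : Mat n) * (γ 0 : Mat n)⁻¹) t)ᵀ := by
  refine eq_halfFlow_conj (X := fun t => (γ t : Mat n)) (fun t => ?_) t
  have hd := isUnit_det_of_posDef (γ t).2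
  have h1 : (u 0 : Mat n) * (γ 0 : Mat n)⁻¹ * γ t = u t := by
    rw [← velocity_metricAI h t, nonsing_inv_mul_cancel_right _ _ hd]
  have h2 : (γ t : Mat n) * ((u 0 : Mat n) * (γ 0 : Mat n)⁻¹)ᵀ = u t := by
    have := congrArg transpose h1
    rwa [transpose_mul, (isSymm_of_posDef (γ t).2).eq, (u t).2.eq] at this
  rw [h1, h2, ← two_smul ℝ, smul_smul]
  simpa using h.1 t

theorem isSymm_conj {n : ℕ} {X : Mat n} (hX : X.IsSymm) (B : Mat n) : (B * X * Bᵀ).IsSymm := by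
  rw [IsSymm, transpose_mul, transpose_mul, transpose_transpose, hX.eq, Matrix.mul_assoc]

theorem exists_isGeodesic_metricAI {n : ℕ} (P : SPD n) (W : Sym n) :
    ∃ γ u, IsGeodesic metricAI γ u ∧ γ 0 = P ∧ u 0 = W ∧
      ∀ X : Sym n, ∃ V, IsParallel metricAI γ u V ∧ V 0 = X := by
  have hd := isUnit_det_of_posDef P.2
  set A : Mat n := (W : Mat n) * (P : Mat n)⁻¹ with hA
  have hAP : A * P = W := nonsing_inv_mul_cancel_right _ _ hd
  have hPA : (P : Mat n) * Aᵀ = W := by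
    have := congrArg transpose hAP
    rwa [transpose_mul, (isSymm_of_posDef P.2).eq, W.2.eq] at this
  let γ : ℝ → SPD n := fun t => ⟨halfFlow A t * P * (halfFlow A t)ᵀ,
    posDef_mul_mul_transpose P.2 (isUnit_halfFlow A t)⟩
  let V (X : Sym n) : ℝ → Sym n := fun t => ⟨halfFlow A t * X * (halfFlow A t)ᵀ,
    isSymm_conj X.2 _⟩
  have h1 (t) : A * (γ t : Mat n) = V W t := by
    change A * (halfFlow A t * P * (halfFlow A t)ᵀ) = halfFlow A t * W * (halfFlow A t)ᵀ
    rw [← hAP]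
    simp only [← Matrix.mul_assoc, commute_halfFlow]
  have h2 (t) : (γ t : Mat n) * Aᵀ = V W t := by
    have := congrArg transpose (h1 t)
    rwa [transpose_mul, (isSymm_of_posDef (γ t).2).eq, (V W t).2.eq] at this
  have hγ : IsVelocity γ (V W) := fun t => by
    have h3 := hasDerivAt_halfFlow_conj A P t
    change HasDerivAt _ ((1 / 2 : ℝ) • (A * (γ t : Mat n) + (γ t : Mat n) * Aᵀ)) t at h3
    rw [h1, h2, ← two_smul ℝ, smul_smul] at h3
    norm_num at h3
    exact h3
  have hV (X : Sym n) : IsParallel metricAI γ (V W) (V X) := by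
    refine (isParallel_metricAI_iff γ (V W) (V X)).2 fun t => ?_
    have hdt := isUnit_det_of_posDef (γ t).2
    have e1 : (V W t : Mat n) * (γ t : Mat n)⁻¹ = A := by
      rw [← h1, mul_nonsing_inv_cancel_right _ _ hdt]
    have e2 : (γ t : Mat n)⁻¹ * V W t = Aᵀ := by
      rw [← h2, nonsing_inv_mul_cancel_left _ _ hdt]
    rw [e1, Matrix.mul_assoc (V X t : Mat n), e2]
    exact hasDerivAt_halfFlow_conj A X t
  have hV0 (X : Sym n) : V X 0 = X := Subtype.ext (by simp [V, halfFlow_zero])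
  exact ⟨γ, V W, ⟨hγ, hV W⟩, Subtype.ext (by simp [γ, halfFlow_zero]), hV0 W,
    fun X => ⟨V X, hV X, hV0 X⟩⟩

/-! ### Exponential, logarithm and transport of the Affine-Invariant metric. -/

theorem Exp_metricAI {n : ℕ} (P : SPD n) (W : Sym n) : (Exp metricAI P W : Mat n) =
    halfFlow ((W : Mat n) * (P : Mat n)⁻¹) 1 * P *
      (halfFlow ((W : Mat n) * (P : Mat n)⁻¹) 1)ᵀ := by
  obtain ⟨γ, u, hγ, h0, hu, -⟩ := exists_isGeodesic_metricAI P W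
  obtain ⟨γ', u', h', h0', hu', h1'⟩ := Classical.epsilon_spec
    (p := fun Q => ∃ γ u, IsGeodesic metricAI γ u ∧ γ 0 = P ∧ u 0 = W ∧ γ 1 = Q)
    ⟨γ 1, γ, u, hγ, h0, hu, rfl⟩
  have h := geodesic_metricAI h' 1
  rw [h1', h0', hu'] at h
  exact h

theorem halfFlow_symm_mul {n : ℕ} {A : Mat n} (hA : A.IsSymm) :
    halfFlow A 1 * (halfFlow A 1)ᵀ = exp A := by
  rw [halfFlow, ← exp_transpose, one_smul, transpose_smul, hA.eq, exp_half_mul_half]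

theorem Exp_one_metricAI {n : ℕ} (W : Sym n) : (Exp metricAI (one n) W : Mat n) = exp (W : Mat n) := by
  rw [Exp_metricAI]
  simp [one, halfFlow_symm_mul W.2]

theorem Log_one_metricAI {n : ℕ} (Q : SPD n) :
    (Log metricAI (one n) Q : Mat n) = logm (Q : Mat n) := by
  have h : Exp metricAI (one n) (Log metricAI (one n) Q) = Q :=
    Classical.epsilon_spec (p := fun W => Exp metricAI (one n) W = Q)
      ⟨⟨logm (Q : Mat n), logm_isSymm _⟩, Subtype.ext (by
        rw [Exp_one_metricAI]; exact exp_logm Q.2)⟩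
  have h2 := Exp_one_metricAI (Log metricAI (one n) Q)
  rw [h] at h2
  rw [h2, logm_exp (Log metricAI (one n) Q).2]

/-- The symmetric square root. -/
def rootm {n : ℕ} (P : Mat n) : Mat n := exp ((1 / 2 : ℝ) • logm P)

theorem rootm_mul_self {n : ℕ} {P : Mat n} (hP : P.PosDef) : rootm P * rootm P = P := by
  rw [rootm, exp_half_mul_half, exp_logm hP]

theorem rootm_isSymm {n : ℕ} (P : Mat n) : (rootm P).IsSymm :=
  ((logm_isSymm P).smul _).exp

theorem isUnit_det_rootm {n : ℕ} (P : Mat n) : IsUnit (rootm P).det :=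
  (Matrix.isUnit_iff_isUnit_det _).1 (Matrix.isUnit_exp _)

theorem rootm_inv {n : ℕ} {P : Mat n} (hP : P.PosDef) : rootm P⁻¹ = (rootm P)⁻¹ := by
  have h : logm P⁻¹ = -logm P := by
    conv_lhs => rw [← exp_logm hP, ← Matrix.exp_neg]
    exact logm_exp (logm_isSymm P).neg
  rw [rootm, h, rootm, smul_neg, Matrix.exp_neg]

theorem transport_one_metricAI {n : ℕ} (P : SPD n) (W : Sym n) :
    (transport metricAI (one n) P W : Mat n) = rootm (P : Mat n) * W * rootm (P : Mat n) := by
  have key {γ : ℝ → SPD n} {u : ℝ → Sym n} (h : IsGeodesic metricAI γ u) (h0 : γ 0 = one n) :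
      (γ 1 : Mat n) = exp (u 0 : Mat n) := by
    rw [geodesic_metricAI h 1, h0]
    simp [one, halfFlow_symm_mul (u 0).2]
  obtain ⟨γ, u, hγ, h0, hu, hV⟩ := exists_isGeodesic_metricAI (one n)
    ⟨logm (P : Mat n), logm_isSymm _⟩
  obtain ⟨V, hV, hV0⟩ := hV W
  have h1 : γ 1 = P := Subtype.ext (by rw [key hγ h0, hu]; exact exp_logm P.2)
  obtain ⟨γ', u', V', h', h0', h1', hp', hV', hV1⟩ := Classical.epsilon_spec
    (p := fun W' => ∃ γ u V, IsGeodesic metricAI γ u ∧ γ 0 = one n ∧ γ 1 = P ∧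
      IsParallel metricAI γ u V ∧ V 0 = W ∧ V 1 = W') ⟨V 1, γ, u, V, hγ, h0, h1, hV, hV0, rfl⟩
  have h2 := key h' h0'
  rw [h1'] at h2
  have h3 := parallel_metricAI h' hp' 1
  -- The endpoint determines the geodesic: `exp (u' 0) = P` forces `u' 0 = logm P`, so the half flow
  -- at time one is the square root of `P`.
  have h4 : halfFlow ((u' 0 : Mat n) * (γ' 0 : Mat n)⁻¹) 1 = rootm (P : Mat n) := by
    rw [h0', h2, rootm, logm_exp (u' 0).2]
    simp [one, halfFlow]
  rw [hV1, hV', h4, (rootm_isSymm _).eq] at h3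
  exact h3

/-- With `S = P^(1/2)`, the transported vector is `S (log Q) S`, and its product with `P⁻¹` is `S
(log Q) S⁻¹`. The half flow is then `S Q^(1/2) S⁻¹`, and letting it act on `P = S S` gives `S Q S`.
-/
theorem oplus_ai {n : ℕ} (P Q : SPD n) :
    (oplus .ai P Q : Mat n) = rootm (P : Mat n) * Q * rootm (P : Mat n) := by
  change (Exp metricAI P (transport metricAI (one n) P (Log metricAI (one n) Q)) : Mat n) = _
  rw [Exp_metricAI, transport_one_metricAI, Log_one_metricAI]
  set S := rootm (P : Mat n) with hS
  have hSu : IsUnit S.det := isUnit_det_rootm _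
  have hSs : Sᵀ = S := rootm_isSymm _
  have hSP : S * S = P := rootm_mul_self P.2
  have e : S * logm (Q : Mat n) * S * (P : Mat n)⁻¹ = S * logm (Q : Mat n) * S⁻¹ := by
    rw [← hSP, Matrix.mul_inv_rev, ← Matrix.mul_assoc, mul_nonsing_inv_cancel_right _ _ hSu]
  have e2 : halfFlow (S * logm (Q : Mat n) * S⁻¹) 1 = S * rootm (Q : Mat n) * S⁻¹ := by
    rw [halfFlow, one_smul, rootm, ← Matrix.exp_conj _ _ ((Matrix.isUnit_iff_isUnit_det S).2 hSu),
      Matrix.mul_smul, Matrix.smul_mul]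
  rw [e, e2, ← hSP, transpose_mul, transpose_mul, transpose_nonsing_inv, hSs,
    (rootm_isSymm _).eq]
  simp only [Matrix.mul_assoc, nonsing_inv_mul_cancel_left _ _ hSu,
    mul_nonsing_inv_cancel_left _ _ hSu]
  rw [← Matrix.mul_assoc (rootm (Q : Mat n)), rootm_mul_self Q.2]

/-! ### Inverses, gyrodistance and gyroautomorphisms of the Affine-Invariant geometry. -/

theorem inv_mul_mul_inv_of_mul_self {n : ℕ} {S T : Mat n} (hS : IsUnit S.det) (h : S * S = T) :
    S⁻¹ * T * S⁻¹ = 1 := by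
  rw [← h, nonsing_inv_mul_cancel_left _ _ hS, mul_nonsing_inv _ hS]

theorem ominus_ai {n : ℕ} (P : SPD n) : (ominus .ai P : Mat n) = (P : Mat n)⁻¹ := by
  have h : oplus .ai (ominus .ai P) P = one n :=
    Classical.epsilon_spec (p := fun X => oplus .ai X P = one n) ⟨⟨(P : Mat n)⁻¹, P.2.inv⟩,
      Subtype.ext (by
        rw [oplus_ai]
        change rootm (P : Mat n)⁻¹ * P * rootm (P : Mat n)⁻¹ = 1
        rw [rootm_inv P.2]
        exact inv_mul_mul_inv_of_mul_self (isUnit_det_rootm _) (rootm_mul_self P.2))⟩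
  have h2 := oplus_ai (ominus .ai P) P
  rw [h] at h2
  change (1 : Mat n) = _ at h2
  have hu := isUnit_det_rootm (ominus .ai P : Mat n)
  symm
  apply inv_eq_right_inv
  rw [← rootm_mul_self (ominus .ai P).2]
  -- Uniqueness of the left inverse: with `S` the root of `⊖ P`, conjugating `1 = S P S` by `S`
  -- yields `1 = P (S S)`.
  have h3 := congrArg (fun M => (rootm (ominus .ai P : Mat n))⁻¹ * M * rootm (ominus .ai P : Mat n)) h2
  simp only [Matrix.mul_one, nonsing_inv_mul _ hu, Matrix.mul_assoc,
    nonsing_inv_mul_cancel_left _ _ hu] at h3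
  exact h3.symm

/-- Conjugation of an SPD matrix by an invertible matrix. -/
def conj {n : ℕ} (O : Mat n) (hO : O * Oᵀ = 1) (P : SPD n) : SPD n :=
  ⟨O * P * Oᵀ, posDef_mul_mul_transpose P.2 (IsUnit.of_mul_eq_one _ hO)⟩

theorem exp_conj_orthogonal {n : ℕ} {O : Mat n} (hO : O * Oᵀ = 1) (X : Mat n) :
    exp (O * X * Oᵀ) = O * exp X * Oᵀ := by
  rw [← inv_eq_right_inv hO]
  exact Matrix.exp_conj O X (IsUnit.of_mul_eq_one _ hO)

theorem logm_conj {n : ℕ} {O P : Mat n} (hO : O * Oᵀ = 1) (hP : P.PosDef) :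
    logm (O * P * Oᵀ) = O * logm P * Oᵀ := by
  conv_lhs => rw [← exp_logm hP, ← exp_conj_orthogonal hO]
  exact logm_exp (isSymm_conj (logm_isSymm P) O)

theorem rootm_conj {n : ℕ} {O P : Mat n} (hO : O * Oᵀ = 1) (hP : P.PosDef) :
    rootm (O * P * Oᵀ) = O * rootm P * Oᵀ := by
  rw [rootm, logm_conj hO hP, rootm, ← exp_conj_orthogonal hO, Matrix.mul_smul, Matrix.smul_mul]

theorem gyrodist_ai {n : ℕ} (P Q : SPD n) : gyrodist .ai P Q =
    Real.sqrt ((logm ((rootm (P : Mat n))⁻¹ * (Q : Mat n) * (rootm (P : Mat n))⁻¹) *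
      logm ((rootm (P : Mat n))⁻¹ * (Q : Mat n) * (rootm (P : Mat n))⁻¹)).trace) := by
  rw [gyrodist, spdNorm, spdInner]
  change Real.sqrt (metricAI (1 : Mat n) (Log metricAI (one n) _) (Log metricAI (one n) _)) = _
  rw [Log_one_metricAI, oplus_ai, ominus_ai, rootm_inv P.2, metricAI]
  simp

theorem gyrodist_conj {n : ℕ} {O : Mat n} (hO : O * Oᵀ = 1) (P Q : SPD n) :
    gyrodist .ai (conj O hO P) (conj O hO Q) = gyrodist .ai P Q := by
  have hO' : Oᵀ * O = 1 := mul_eq_one_comm.1 hO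
  have hc (X Y : Mat n) : O * X * Oᵀ * (O * Y * Oᵀ) = O * (X * Y) * Oᵀ := by
    have : Oᵀ * (O * (Y * Oᵀ)) = Y * Oᵀ := by rw [← Matrix.mul_assoc, hO', Matrix.one_mul]
    simp only [Matrix.mul_assoc, this]
  have hi (X : Mat n) (hX : IsUnit X.det) : (O * X * Oᵀ)⁻¹ = O * X⁻¹ * Oᵀ :=
    inv_eq_right_inv (by rw [hc, mul_nonsing_inv _ hX, Matrix.mul_one, hO])
  have hu := isUnit_det_rootm (P : Mat n)
  have hpos : ((rootm (P : Mat n))⁻¹ * (Q : Mat n) * (rootm (P : Mat n))⁻¹).PosDef := by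
    have := posDef_mul_mul_transpose Q.2
      ((Matrix.isUnit_nonsing_inv_iff).2 ((Matrix.isUnit_iff_isUnit_det _).2 hu))
    rwa [transpose_nonsing_inv, (rootm_isSymm _).eq] at this
  rw [gyrodist_ai, gyrodist_ai]
  simp only [conj]
  rw [rootm_conj hO P.2, hi _ hu, hc, hc, logm_conj hO hpos, hc, Matrix.trace_mul_comm,
    ← Matrix.mul_assoc, hO', Matrix.one_mul]

theorem isGyroisometry_gyr_ai {n : ℕ} (P Q : SPD n) : IsGyroisometry .ai (gyr .ai P Q) := by
  set T := rootm (oplus .ai P Q : Mat n) with hT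
  -- This is the product of the three roots that stand to the left of `R` when the formulas for
  -- `oplus` and `ominus` are expanded in `gyr`.
  set O : Mat n := T⁻¹ * rootm (P : Mat n) * rootm (Q : Mat n) with hOdef
  have hTu : IsUnit T.det := isUnit_det_rootm _
  have hTt : (T⁻¹)ᵀ = T⁻¹ := by rw [transpose_nonsing_inv, (rootm_isSymm _).eq]
  have hOt : Oᵀ = rootm (Q : Mat n) * rootm (P : Mat n) * T⁻¹ := by
    rw [hOdef, transpose_mul, transpose_mul, hTt, (rootm_isSymm _).eq, (rootm_isSymm _).eq,
      Matrix.mul_assoc]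
  have hO : O * Oᵀ = 1 := by
    have h1 : T * T = rootm (P : Mat n) * (Q : Mat n) * rootm (P : Mat n) := by
      rw [← oplus_ai]; exact rootm_mul_self (oplus .ai P Q).2
    have h2 : O * Oᵀ = T⁻¹ * (T * T) * T⁻¹ := by
      have hq := rootm_mul_self Q.2
      rw [h1, hOt, hOdef]
      simp only [Matrix.mul_assoc]
      rw [← Matrix.mul_assoc (rootm (Q : Mat n)) (rootm (Q : Mat n)), hq]
    rw [h2, inv_mul_mul_inv_of_mul_self hTu rfl]
  have hg (R : SPD n) : gyr .ai P Q R = conj O hO R := by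
    apply Subtype.ext
    rw [gyr, oplus_ai (ominus .ai _), ominus_ai, rootm_inv (oplus .ai P Q).2, oplus_ai P (oplus .ai Q R),
      oplus_ai Q R]
    change _ = O * R * Oᵀ
    rw [hOt, hOdef]
    simp only [Matrix.mul_assoc, hT]
  intro R S
  rw [hg, hg, gyrodist_conj]

end SPDGyro

end

theorem mainTheorem10 (n : ℕ) (g : SPDGyro.Geometry) (P Q : SPDGyro.SPD n) :
    SPDGyro.IsGyroisometry g (SPDGyro.gyr g P Q) := by
  cases g with
  | le => exact SPDGyro.FlatChart.isGyroisometry_gyr (g := .le) (SPDGyro.flatChartLE n) P Q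
  | lc => exact SPDGyro.FlatChart.isGyroisometry_gyr (g := .lc) (SPDGyro.flatChartLC n) P Q
  | ai => exact SPDGyro.isGyroisometry_gyr_ai P Q
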